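/- Let $n\ge 2$, let $\Delta_n=\{p\in(0,1)^n:\sum_i p_i=1\}$ be the open unit simplex, and for $p,q\in\Delta_n$ put $$p\odot q=\Big(\frac{p_iq_i}{\sum_j p_jq_j}\Big)_i,\qquad p^{-1}=\Big(\frac{1/p_i}{\sum_j 1/p_j}\Big)_i,\qquad c(p,q)=\log\Big(\frac1n\sum_{i}\frac{q_i}{p_i}\Big)-\frac1n\sum_{i}\log\frac{q_i}{p_i}.$$ For Borel probability measures $P,Q$ on $\Delta_n$ let $\mathbf C(P,Q)=\inf_R\int c\,dR$, the infimum being over all couplings $R$ of $P$ and $Q$. Let $\mathcal L_a$ be the class of Borel probability measures $P$ on $\Delta_n$ that are absolutely continuous with respect to $(n-1)$-dimensional Lebesgue measure and satisfy $\sum_i\int|\log p_i|\,dP(p)<\infty$. Let $\mu_0$ be the measure on $\Delta_n$ given in the coordinates $(p_1,\dots,p_{n-1})$ by $$d\mu_0(p)=\frac{dp_1\cdots dp_{n-1}}{p_1\cdots p_n},\qquad p_n=1-p_1-\dots-p_{n-1},$$ and for $P\ll\mu_0$ with density $\rho=dP/d\mu_0$ let $\mathrm{Ent}_{\mu_0}(P)=\int\rho\log\rho\,d\mu_0$.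 Let $P_0,P_1\in\mathcal L_a$ and let $\varphi_1:\Delta_n\to\mathbb R$ be exponentially concave (that is, $e^{\varphi_1}$ is concave) with portfolio map $$(\boldsymbol\pi_1(r))_i=r_i\big(1+\nabla_{e_i-r}\varphi_1(r)\big),\qquad 1\le i\le n,$$ such that the map $T_1(p)=p\odot\boldsymbol\pi_1(p^{-1})$ pushes $P_0$ forward to $P_1$. Assume that $\varphi_1$ is twice continuously differentiable on $\Delta_n$ and that the quadratic form $L(r)=-\nabla^2\varphi_1(r)-\nabla\varphi_1(r)\otimes\nabla\varphi_1(r)$ satisfies $v^\top L(r)v>0$ for every $r\in\Delta_n$ and every $v\neq0$ with $v_1+\dots+v_n=0$. For $0\le t\le1$ let $$\boldsymbol\pi_t=(1-t)\big(\tfrac1n,\dots,\tfrac1n\big)+t\,\boldsymbol\pi_1,\qquad T_t(p)=p\odot\boldsymbol\pi_t(p^{-1}),\qquad P_t=(T_t)_\#P_0 .$$ Then for every $t\in[0,1]$ one has $P_t\in\mathcal L_a$, $P_t\ll\mu_0$, $\mathrm{Ent}_{\mu_0}(P_t)$ is well defined in $(-\infty,+\infty]$ (the negative part of $\rho\log\rho$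 is $\mu_0$-integrable), $\mathbf C(P_0,P_t)<\infty$, and the function $$t\mapsto \mathrm{Ent}_{\mu_0}(P_t)+n\,\mathbf C(P_0,P_t)\in(-\infty,+\infty]$$ is convex on $[0,1]$. -/

import Mathlib

open MeasureTheory

noncomputable section

namespace DirichletTransport

/-- The open unit simplex `Δ_n` in `ℝⁿ`. -/
def simplex (n : ℕ) : Set (Fin n → ℝ) :=
  {p | (∀ i, 0 < p i) ∧ ∑ i, p i = 1}

/-- The group operation `p ⊙ q`. -/
def odot {n : ℕ} (p q : Fin n → ℝ) : Fin n → ℝ :=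
  fun i => p i * q i / ∑ j, p j * q j

/-- The group inverse `p⁻¹` on the simplex (not the pointwise inverse). -/
def sinv {n : ℕ} (p : Fin n → ℝ) : Fin n → ℝ :=
  fun i => (1 / p i) / ∑ j, 1 / p j

/-- The barycenter `(1/n, …, 1/n)`. -/
def barycenter (n : ℕ) : Fin n → ℝ := fun _ => 1 / (n : ℝ)

/-- The cost function `c(p, q) = log ((1/n) ∑ qᵢ/pᵢ) - (1/n) ∑ log (qᵢ/pᵢ)`. -/
def cost {n : ℕ} (p q : Fin n → ℝ) : ℝ :=
  Real.log (1 / (n : ℝ) * ∑ i, q i / p i) - 1 / (n : ℝ) * ∑ i, Real.log (q i / p i)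

/-- The set of couplings of `P` and `Q`. -/
def couplings {n : ℕ} (P Q : Measure (Fin n → ℝ)) :
    Set (Measure ((Fin n → ℝ) × (Fin n → ℝ))) :=
  {γ | γ.map Prod.fst = P ∧ γ.map Prod.snd = Q}

/-- The optimal transport cost `C(P, Q)`; the cost function is nonnegative on the simplex, so
`ENNReal.ofReal` loses nothing for measures carried by the simplex. -/
def transportCost {n : ℕ} (P Q : Measure (Fin n → ℝ)) : ENNReal :=
  ⨅ γ ∈ couplings P Q, ∫⁻ x, ENNReal.ofReal (cost x.1 x.2) ∂γ

/-- The coordinate domain `D_{n-1}` of the simplex. -/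
def coordDomain (n : ℕ) : Set (Fin (n - 1) → ℝ) :=
  {x | (∀ i, 0 < x i) ∧ ∑ i, x i < 1}

/-- The parameterization `(p₁, …, p_{n-1}) ↦ (p₁, …, p_{n-1}, 1 - p₁ - ⋯ - p_{n-1})`. -/
def chart (n : ℕ) (x : Fin (n - 1) → ℝ) : Fin n → ℝ :=
  fun i => if h : (i : ℕ) < n - 1 then x ⟨i, h⟩ else 1 - ∑ j, x j

/-- The `(n-1)`-dimensional Lebesgue measure `dp₁ ⋯ dp_{n-1}` on the simplex. -/
def lebesgueSimplex (n : ℕ) : Measure (Fin n → ℝ) :=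
  (volume.restrict (coordDomain n)).map (chart n)

/-- The reference measure `dμ₀ = (p₁ ⋯ p_n)⁻¹ dp₁ ⋯ dp_{n-1}` on the simplex. -/
def refMeasure (n : ℕ) : Measure (Fin n → ℝ) :=
  (lebesgueSimplex n).withDensity fun p => ENNReal.ofReal (1 / ∏ i, p i)

/-- The class `𝓛`: Borel probability measures on the simplex with finite logarithmic moments.
Measures on the simplex are regarded as measures on `ℝⁿ` carried by the simplex. -/
structure ClassL {n : ℕ} (P : Measure (Fin n → ℝ)) : Prop where
  isProbabilityMeasure : IsProbabilityMeasure P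
  carried : P (simplex n)ᶜ = 0
  logMoment : ∑ i, ∫⁻ p, ENNReal.ofReal |Real.log (p i)| ∂P < ⊤

/-- The class `𝓛ₐ` of absolutely continuous measures in `𝓛`. -/
structure ClassLa {n : ℕ} (P : Measure (Fin n → ℝ)) : Prop extends ClassL P where
  absolutelyContinuous : P ≪ lebesgueSimplex n

/-- Exponential concavity on the simplex. Only the values of `φ` on the simplex matter, here and
in all notions below. -/
def ExpConcave {n : ℕ} (φ : (Fin n → ℝ) → ℝ) : Prop :=
  ConcaveOn ℝ (simplex n) fun r => Real.exp (φ r)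

/-- The portfolio map `(π(r))ᵢ = rᵢ (1 + ∇_{eᵢ - r} φ(r))` generated by `φ`. -/
def portfolio {n : ℕ} (φ : (Fin n → ℝ) → ℝ) (r : Fin n → ℝ) : Fin n → ℝ :=
  fun i => r i * (1 + lineDeriv ℝ φ r (Pi.single i 1 - r))

/-- The quadratic form `v ↦ vᵀ L(r) v`, with `L = -∇²φ - ∇φ ⊗ ∇φ`, on tangent vectors `v` of the
simplex, written through derivatives of `φ` along the line `h ↦ r + h v`. -/
def quadL {n : ℕ} (φ : (Fin n → ℝ) → ℝ) (r v : Fin n → ℝ) : ℝ :=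
  -iteratedDeriv 2 (fun h : ℝ => φ (r + h • v)) 0 - (lineDeriv ℝ φ r v) ^ 2

/-- `φ` is twice continuously differentiable on the simplex and `L(r)` is strictly positive
definite on tangent vectors at every point `r` of the simplex. -/
structure Regular {n : ℕ} (φ : (Fin n → ℝ) → ℝ) : Prop where
  contDiffOn : ContDiffOn ℝ 2 φ (simplex n)
  posDef : ∀ r ∈ simplex n, ∀ v : Fin n → ℝ, ∑ i, v i = 0 → v ≠ 0 → 0 < quadL φ r v

/-- The interpolated portfolio map `π_t = (1 - t) ē + t π₁`. -/
def portfolioAt {n : ℕ} (φ : (Fin n → ℝ) → ℝ) (t : ℝ) (r : Fin n → ℝ) : Fin n → ℝ :=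
  (1 - t) • barycenter n + t • portfolio φ r

/-- The map `T_t(p) = p ⊙ π_t(p⁻¹)`. -/
def transportMap {n : ℕ} (φ : (Fin n → ℝ) → ℝ) (t : ℝ) (p : Fin n → ℝ) : Fin n → ℝ :=
  odot p (portfolioAt φ t (sinv p))

/-- The displacement interpolation `P_t = (T_t)_# P₀`. -/
def interpolation {n : ℕ} (P₀ : Measure (Fin n → ℝ)) (φ : (Fin n → ℝ) → ℝ) (t : ℝ) :
    Measure (Fin n → ℝ) :=
  P₀.map (transportMap φ t)

/-- The integrand `ρ log ρ`, where `ρ = dP/dμ₀`. -/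
def entIntegrand {n : ℕ} (P : Measure (Fin n → ℝ)) (p : Fin n → ℝ) : ℝ :=
  (P.rnDeriv (refMeasure n) p).toReal * Real.log (P.rnDeriv (refMeasure n) p).toReal

/-- The integral of the positive part of `ρ log ρ`. -/
def entPos {n : ℕ} (P : Measure (Fin n → ℝ)) : ENNReal :=
  ∫⁻ p, ENNReal.ofReal (entIntegrand P p) ∂(refMeasure n)

/-- The integral of the negative part of `ρ log ρ`. -/
def entNeg {n : ℕ} (P : Measure (Fin n → ℝ)) : ENNReal :=
  ∫⁻ p, ENNReal.ofReal (-entIntegrand P p) ∂(refMeasure n)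

/-- The entropy `∫ ρ log ρ dμ₀` as an extended real number; it is meaningful when `P ≪ μ₀` and the
negative part of `ρ log ρ` is integrable, and then lies in `(-∞, +∞]`. -/
def entropy {n : ℕ} (P : Measure (Fin n → ℝ)) : EReal :=
  (entPos P : EReal) - (entNeg P : EReal)

/-- Convexity on `S` of an extended-real function; `0 * ⊤ = 0` in `EReal`. -/
def EConvexOn (S : Set ℝ) (F : ℝ → EReal) : Prop :=
  ∀ s ∈ S, ∀ t ∈ S, ∀ a b : ℝ, 0 ≤ a → 0 ≤ b → a + b = 1 →
    F (a * s + b * t) ≤ (a : EReal) * F s + (b : EReal) * F t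

end DirichletTransport

end

/-! The proof works in the coordinates `θᵢ = log (pᵢ / p_n)`. There `μ₀` becomes Lebesgue measure on
`ℝ^d`, `d = n - 1`, the product `⊙` becomes addition and the group inverse becomes negation. Put
`Φ(y) = φ₁(softmax y) + log ∑ exp yⱼ`. Then `Φ(y + c) = Φ(y) + c`, the portfolio map is the gradient
of `Φ`, and `T_t` becomes `θ ↦ θ + logRatio (π_t(-θ))`.

With `Cov π = diag π - π πᵀ` (first `d` weights) and `H` the reduced Hessian of `Φ`, the Jacobian of
`T_t` is `J_t = 1 - Cov(π_t)⁻¹ (t H)`, so `Cov(π_t) J_t = A_t := Cov(π_t) - t H`. Moreover `det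
Cov(π_t)` is the product of all `n` weights, while the cost from `p` to `T_t p` is `-log n - (1/n) ∑
log π_{t,i}`. Hence `-log det J_t + n c(p, T_t p) = -log det A_t - n log n`: the multiple `n` of the
cost cancels exactly the factor that spoils convexity.

The weights `π_t` are affine in `t`, and `Cov` along a segment exceeds its chord by a rank-one
positive semidefinite matrix; `t H` is linear. So `t ↦ A_t` is concave in the Loewner order. It is
positive definite at `t = 0`, and at `t = 1` by positivity of `L`, hence on all of `[0,1]`. Since
`log det` is monotone and concave (`log_det_interpMatrix_concave`), the integrand is convex in `t`
at each `θ`. Integration against `P₀`, by the Monge–Ampère equation `pullback_eq_withDensity`, gives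
the convexity of the functional.

For this, `T_t` must be optimal. Strict concavity of `exp φ₁` along segments gives `exp (Φ(y') -
Φ(y)) < ∑ πᵢ(y) exp (y'ᵢ - yᵢ)`. This inequality yields positivity of the weights, a dual
certificate for each `T_t` (`dualPotential_sub_le`) and, through its strict form, injectivity of
`T_t` for `t > 0`. The log moments of `P_t` are controlled by those of `P₀` and `P₁`, and they make
the entropy well defined and the cost finite. -/

noncomputable section

namespace DirichletTransport

/-! ### Monotonicity and concavity of `log det`. -/

section Determinants

open Matrix

open scoped MatrixOrder Matrix.Norms.L2Operator in
/-- A positive definite matrix `A` and a symmetric matrix `B` are simultaneously diagonalized by a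
congruence; here is the resulting formula for the determinants of the pencil they span. -/
theorem exists_det_pencil_eq {ι : Type*} [Fintype ι] [DecidableEq ι] {A B : Matrix ι ι ℝ}
    (hA : A.PosDef) (hB : B.IsHermitian) :
    ∃ (c : ℝ) (m : ι → ℝ), 0 < c ∧ (B.PosSemidef → ∀ i, 0 ≤ m i) ∧ (B.PosDef → ∀ i, 0 < m i) ∧
      ∀ a b : ℝ, (a • A + b • B).det = c * ∏ i, (a + b * m i) := by
  -- With `A = Cᴴ C`, the congruence by `C⁻¹` turns `A` into the identity and `B` into `C⁻¹ᴴ B C⁻¹`,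
  -- which is diagonalized orthogonally. So `m` consists of the eigenvalues of the latter, and `c =
  -- det A`.
  obtain ⟨C, hC⟩ := CStarAlgebra.nonneg_iff_eq_star_mul_self.mp hA.posSemidef.nonneg
  rw [star_eq_conjTranspose] at hC
  have hdetA : C.det * C.det = A.det := by
    rw [hC, det_mul, det_conjTranspose]; simp
  have hCdet : IsUnit C.det := by
    refine isUnit_iff_ne_zero.mpr fun h => ?_
    have := hA.det_pos
    rw [← hdetA, h] at this
    simp at this
  have hCu : IsUnit C := (isUnit_iff_isUnit_det C).mpr hCdet
  have hDu : IsUnit C⁻¹ := isUnit_nonsing_inv_iff.mpr hCu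
  have hM : (C⁻¹ᴴ * B * C⁻¹).IsHermitian := isHermitian_conjTranspose_mul_mul _ hB
  have hstar : Cᴴ * C⁻¹ᴴ = 1 := by
    rw [← conjTranspose_mul, nonsing_inv_mul _ hCdet, conjTranspose_one]
  refine ⟨A.det, hM.eigenvalues, hA.det_pos, fun h i => ?_, fun h i => ?_, fun a b => ?_⟩
  · exact (h.conjTranspose_mul_mul_same C⁻¹).eigenvalues_nonneg i
  · exact (h.conjTranspose_mul_mul_same
      (mulVec_injective_of_isUnit hDu)).eigenvalues_pos i
  · have hB' : B = Cᴴ * (C⁻¹ᴴ * B * C⁻¹) * C := by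
      calc B = (Cᴴ * C⁻¹ᴴ) * B * (C⁻¹ * C) := by
            rw [hstar, nonsing_inv_mul _ hCdet, one_mul, mul_one]
        _ = _ := by simp only [mul_assoc]
    have h1 : a • A + b • B = Cᴴ * (a • 1 + b • (C⁻¹ᴴ * B * C⁻¹)) * C := by
      rw [mul_add, add_mul]
      simp only [Matrix.mul_smul, Matrix.smul_mul, mul_one]
      rw [← hB', ← hC]
    have h2 : (a • (1 : Matrix ι ι ℝ) + b • (C⁻¹ᴴ * B * C⁻¹)).det
        = ∏ i, (a + b * hM.eigenvalues i) := by
      conv_lhs => rw [hM.spectral_theorem, Unitary.conjStarAlgAut_apply]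
      set U : Matrix ι ι ℝ := (hM.eigenvectorUnitary : Matrix ι ι ℝ)
      have hU : U * star U = 1 := Unitary.coe_mul_star_self hM.eigenvectorUnitary
      have h3 : a • (1 : Matrix ι ι ℝ) + b • (U * diagonal (RCLike.ofReal ∘ hM.eigenvalues) *
          star U) = U * diagonal (fun i => a + b * hM.eigenvalues i) * star U := by
        have : diagonal (fun i => a + b * hM.eigenvalues i) =
            a • (1 : Matrix ι ι ℝ) + b • diagonal (RCLike.ofReal ∘ hM.eigenvalues) := by
          ext i j
          by_cases hij : i = j <;> simp [hij, diagonal]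
        rw [this, mul_add, add_mul]
        simp only [Matrix.mul_smul, Matrix.smul_mul, mul_one, hU]
      have h4 : U.det * (star U).det = 1 := by rw [← det_mul, hU, det_one]
      rw [h3, det_mul, det_mul, det_diagonal]
      linear_combination (∏ i, (a + b * hM.eigenvalues i)) * h4
    rw [h1, det_mul, det_mul, h2, ← hdetA, det_conjTranspose]
    simp only [star_trivial]
    ring

/-- On the pencil, passing from `A` to `A + N` multiplies the determinant by `∏ (1 + mᵢ)` with `mᵢ ≥
0`. -/
theorem det_le_det_add {ι : Type*} [Fintype ι] [DecidableEq ι] {A N : Matrix ι ι ℝ}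
    (hA : A.PosDef) (hN : N.PosSemidef) : A.det ≤ (A + N).det := by
  obtain ⟨c, m, hc, hm, -, h⟩ := exists_det_pencil_eq hA hN.isHermitian
  have h0 := h 1 0
  have h1 := h 1 1
  simp only [one_smul, zero_smul, add_zero, zero_mul, Finset.prod_const_one, mul_one, one_mul]
    at h0 h1
  rw [h0, h1]
  have := Finset.prod_le_prod (s := Finset.univ) (f := fun _ : ι => (1 : ℝ))
    (g := fun i => 1 + m i) (fun _ _ => zero_le_one) fun i _ => by linarith [hm hN i]
  exact le_mul_of_one_le_right hc.le (by simpa using this)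

/-- Concavity of `log det` on positive definite matrices. -/
theorem log_det_concave {ι : Type*} [Fintype ι] [DecidableEq ι] {A B : Matrix ι ι ℝ}
    (hA : A.PosDef) (hB : B.PosDef) {a b : ℝ} (ha : 0 ≤ a) (hb : 0 ≤ b) (hab : a + b = 1) :
    a * Real.log A.det + b * Real.log B.det ≤ Real.log (a • A + b • B).det := by
  obtain ⟨c, m, hc, -, hm, h⟩ := exists_det_pencil_eq hA hB.isHermitian
  have hm := hm hB
  have h0 := h 1 0
  have h1 := h 0 1
  simp only [one_smul, zero_smul, add_zero, zero_add, zero_mul, Finset.prod_const_one, mul_one,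
    one_mul] at h0 h1
  have hpos : ∀ i, 0 < a + b * m i := fun i => by
    rcases ha.eq_or_lt with rfl | ha'
    · have : b = 1 := by linarith
      subst this; simpa using hm i
    · have := mul_nonneg hb (hm i).le
      linarith
  rw [h, h0, h1, Real.log_mul hc.ne' (Finset.prod_pos fun i _ => hm i).ne',
    Real.log_mul hc.ne' (Finset.prod_pos fun i _ => hpos i).ne',
    Real.log_prod fun i _ => (hm i).ne', Real.log_prod fun i _ => (hpos i).ne']
  -- The matrix inequality reduces to concavity of the scalar logarithm between `1` and each `mᵢ`.
  have key : ∀ i, b * Real.log (m i) ≤ Real.log (a + b * m i) := fun i => by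
    have := strictConcaveOn_log_Ioi.concaveOn.2 (Set.mem_Ioi.mpr one_pos)
      (Set.mem_Ioi.mpr (hm i)) ha hb hab
    simpa using this
  have hs := Finset.sum_le_sum fun i (_ : i ∈ Finset.univ) => key i
  rw [← Finset.mul_sum] at hs
  have : a * Real.log c + b * Real.log c = Real.log c := by rw [← add_mul, hab, one_mul]
  linarith

end Determinants

/-! ### The covariance matrix of a probability vector, last entry dropped. -/

section CovarianceMatrix

open Matrix

variable {d : ℕ}

/-- The matrix `diag p - p pᵀ`. -/
def covMatrix (p : Fin d → ℝ) : Matrix (Fin d) (Fin d) ℝ :=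
  Matrix.diagonal p - Matrix.vecMulVec p p

/-- The inverse of `covMatrix p`. -/
def covMatrixInv (p : Fin d → ℝ) : Matrix (Fin d) (Fin d) ℝ :=
  Matrix.diagonal (fun i => 1 / p i) + Matrix.of fun _ _ => 1 / (1 - ∑ j, p j)

/-- Factoring out `diag p` leaves a rank-one perturbation of the identity, so the matrix determinant
lemma applies. When `p` is completed to a probability vector the result is the product of all its
entries. -/
theorem det_covMatrix (p : Fin d → ℝ) :
    (covMatrix p).det = (∏ i, p i) * (1 - ∑ i, p i) := by
  have h : covMatrix p = Matrix.diagonal p *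
      (1 + replicateCol Unit (fun _ : Fin d => (-1 : ℝ)) * replicateRow Unit p) := by
    rw [Matrix.mul_add, Matrix.mul_one]
    ext i j
    rw [Matrix.add_apply, diagonal_mul, Matrix.mul_apply]
    simp [covMatrix, vecMulVec_apply, sub_eq_add_neg]
  rw [h, det_mul, det_diagonal, det_one_add_replicateCol_mul_replicateRow]
  simp [dotProduct, sub_eq_add_neg]

theorem covMatrix_mul_covMatrixInv {p : Fin d → ℝ} (hp : ∀ i, 0 < p i) (hs : ∑ i, p i < 1) :
    covMatrix p * covMatrixInv p = 1 := by
  have hs' : 1 - ∑ i, p i ≠ 0 := by linarith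
  ext i j
  have hsum : ∑ k, p k * covMatrixInv p k j = 1 / (1 - ∑ k, p k) := by
    simp only [covMatrixInv, Matrix.add_apply, Matrix.of_apply, diagonal_apply, mul_add,
      Finset.sum_add_distrib, ← Finset.sum_mul]
    simp only [mul_ite, mul_zero, Finset.sum_ite_eq', Finset.mem_univ, if_true]
    have := (hp j).ne'
    field_simp
    ring
  have : (covMatrix p * covMatrixInv p) i j =
      p i * covMatrixInv p i j - p i * ∑ k, p k * covMatrixInv p k j := by
    rw [covMatrix, Matrix.sub_mul, Matrix.sub_apply, diagonal_mul, Matrix.mul_apply]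
    simp only [vecMulVec_apply, Finset.mul_sum, mul_assoc]
  rw [this, hsum]
  have := (hp i).ne'
  by_cases hij : i = j
  · subst hij
    simp [covMatrixInv]
    field_simp
    ring
  · simp [covMatrixInv, hij]

theorem covMatrix_isHermitian (p : Fin d → ℝ) : (covMatrix p).IsHermitian := by
  ext i j
  simp only [covMatrix, conjTranspose_apply, Matrix.sub_apply, vecMulVec_apply, star_trivial,
    mul_comm (p i), diagonal_apply]
  by_cases hij : i = j
  · subst hij; simp
  · simp [hij, Ne.symm hij]

/-- The quadratic form is the variance of `v`, extended by `0` on the dropped entry. -/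
theorem dotProduct_covMatrix_mulVec (p v : Fin d → ℝ) :
    v ⬝ᵥ (covMatrix p *ᵥ v) = ∑ i, p i * v i ^ 2 - (∑ i, p i * v i) ^ 2 := by
  have h1 : v ⬝ᵥ (Matrix.diagonal p *ᵥ v) = ∑ i, p i * v i ^ 2 := by
    simp only [dotProduct, mulVec_diagonal]
    exact Finset.sum_congr rfl fun i _ => by ring
  have h2 : v ⬝ᵥ (vecMulVec p p *ᵥ v) = (∑ i, p i * v i) ^ 2 := by
    rw [vecMulVec_mulVec, dotProduct_smul]
    simp [dotProduct, sq, mul_comm]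
  rw [covMatrix, sub_mulVec, dotProduct_sub, h1, h2]

theorem covMatrix_posDef {p : Fin d → ℝ} (hp : ∀ i, 0 < p i) (hs : ∑ i, p i < 1) :
    (covMatrix p).PosDef := by
  refine PosDef.of_dotProduct_mulVec_pos (covMatrix_isHermitian p) fun v hv => ?_
  rw [star_trivial, dotProduct_covMatrix_mulVec]
  -- Cauchy–Schwarz with weights `p`; strictness then comes from the missing mass `1 - ∑ pᵢ > 0`.
  have hcs : (∑ i, p i * v i) ^ 2 ≤ (∑ i, p i) * ∑ i, p i * v i ^ 2 :=
    Finset.sum_sq_le_sum_mul_sum_of_sq_le_mul _ (fun i _ => (hp i).le)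
      (fun i _ => mul_nonneg (hp i).le (sq_nonneg _)) fun i _ => by ring_nf; rfl
  obtain ⟨j, hj⟩ := Function.ne_iff.mp hv
  have hpos : 0 < ∑ i, p i * v i ^ 2 :=
    Finset.sum_pos' (fun i _ => mul_nonneg (hp i).le (sq_nonneg _))
      ⟨j, Finset.mem_univ _, mul_pos (hp j) (by simpa using sq_pos_of_ne_zero hj)⟩
  nlinarith

/-- The matrix `covMatrix` is concave along affine paths, with an explicit defect. -/
theorem covMatrix_affine (p q : Fin d → ℝ) {a b : ℝ} (hab : a + b = 1) :
    covMatrix (a • p + b • q) =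
      a • covMatrix p + b • covMatrix q + (a * b) • vecMulVec (p - q) (p - q) := by
  obtain rfl : b = 1 - a := by linarith
  ext i j
  simp only [covMatrix, Matrix.sub_apply, Matrix.add_apply, Matrix.smul_apply, vecMulVec_apply,
    diagonal_apply, Pi.add_apply, Pi.smul_apply, Pi.sub_apply, smul_eq_mul]
  split_ifs <;> ring

end CovarianceMatrix

/-! ### Softmax: the simplex group in additive form. -/

section Softmax

variable {n : ℕ}

/-- The map `y ↦ (exp yᵢ / ∑ⱼ exp yⱼ)ᵢ`. -/
def softmax (y : Fin n → ℝ) : Fin n → ℝ :=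
  fun i => Real.exp (y i) / ∑ j, Real.exp (y j)

theorem sum_exp_pos [NeZero n] (y : Fin n → ℝ) : 0 < ∑ j, Real.exp (y j) :=
  Finset.sum_pos (fun _ _ => Real.exp_pos _) Finset.univ_nonempty

theorem softmax_pos [NeZero n] (y : Fin n → ℝ) (i : Fin n) : 0 < softmax y i :=
  div_pos (Real.exp_pos _) (sum_exp_pos y)

theorem softmax_sum [NeZero n] (y : Fin n → ℝ) : ∑ i, softmax y i = 1 := by
  simp only [softmax, ← Finset.sum_div]
  exact div_self (sum_exp_pos y).ne'

theorem softmax_mem [NeZero n] (y : Fin n → ℝ) : softmax y ∈ simplex n :=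
  ⟨softmax_pos y, softmax_sum y⟩

theorem log_softmax [NeZero n] (y : Fin n → ℝ) (i : Fin n) :
    Real.log (softmax y i) = y i - Real.log (∑ j, Real.exp (y j)) := by
  rw [softmax, Real.log_div (Real.exp_pos _).ne' (sum_exp_pos y).ne', Real.log_exp]

/-- Softmax has `n` variables for an `(n-1)`-dimensional simplex; this translation is the redundant
direction. -/
theorem softmax_add_const (y : Fin n → ℝ) (c : ℝ) : softmax (fun i => y i + c) = softmax y := by
  ext i
  simp only [softmax, Real.exp_add, ← Finset.sum_mul]
  exact mul_div_mul_right _ _ (Real.exp_pos c).ne'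

theorem softmax_log {r : Fin n → ℝ} (hr : r ∈ simplex n) :
    softmax (fun i => Real.log (r i)) = r := by
  ext i
  simp only [softmax, Real.exp_log (hr.1 _), hr.2, div_one]

theorem contDiff_softmax [NeZero n] {m : WithTop ℕ∞} : ContDiff ℝ m (softmax (n := n)) := by
  rw [contDiff_pi]
  intro i
  exact ContDiff.div (by fun_prop) (by fun_prop) fun y => (sum_exp_pos y).ne'

theorem sinv_softmax [NeZero n] (y : Fin n → ℝ) : sinv (softmax y) = softmax (fun i => -y i) := by
  ext i
  have := sum_exp_pos y
  simp only [sinv, softmax, one_div_div, Real.exp_neg]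
  have h : ∀ j, (∑ k, Real.exp (y k)) / Real.exp (y j) =
    (∑ k, Real.exp (y k)) * (Real.exp (y j))⁻¹ := fun j => div_eq_mul_inv _ _
  simp only [h, ← Finset.mul_sum]
  exact mul_div_mul_left _ _ this.ne'

theorem odot_softmax [NeZero n] (y w : Fin n → ℝ) (hw : ∀ i, 0 < w i) :
    odot (softmax y) w = softmax (fun i => y i + Real.log (w i)) := by
  ext i
  have := sum_exp_pos y
  simp only [odot, softmax, Real.exp_add, Real.exp_log (hw _), div_mul_eq_mul_div,
    ← Finset.sum_div]
  exact div_div_div_cancel_right₀ this.ne' _ _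

/-- The ratio of normalizing sums adds the same constant to both terms of the cost and cancels. The
cost thus depends only on `b - a`. -/
theorem cost_softmax [NeZero n] (a b : Fin n → ℝ) :
    cost (softmax a) (softmax b) =
      Real.log (1 / (n : ℝ) * ∑ i, Real.exp (b i - a i)) - 1 / (n : ℝ) * ∑ i, (b i - a i) := by
  have ha := sum_exp_pos a
  have hb := sum_exp_pos b
  have hba := sum_exp_pos (fun i => b i - a i)
  have hn : (0 : ℝ) < n := by exact_mod_cast Nat.pos_of_ne_zero (NeZero.ne n)
  have h1 : ∀ i, softmax b i / softmax a i = Real.exp (b i - a i) *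
      ((∑ j, Real.exp (a j)) / ∑ j, Real.exp (b j)) := fun i => by
    have := Real.exp_pos (a i)
    simp only [softmax, Real.exp_sub]
    field_simp
  have hq := div_pos ha hb
  have h2 : ∀ i, Real.log (softmax b i / softmax a i) = (b i - a i) +
      Real.log ((∑ j, Real.exp (a j)) / ∑ j, Real.exp (b j)) := fun i => by
    rw [h1, Real.log_mul (Real.exp_pos _).ne' hq.ne', Real.log_exp]
  simp only [cost, h2]
  simp only [h1, ← Finset.sum_mul, Finset.sum_add_distrib, Finset.sum_const, Finset.card_univ,
    Fintype.card_fin, nsmul_eq_mul, ← mul_assoc]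
  rw [Real.log_mul (by positivity) hq.ne']
  field_simp
  ring

end Softmax

/-! ### Logarithmic coordinates and their derivatives. -/

section Coordinates

variable {d : ℕ}

/-- The linear map `(θ₁, …, θ_d) ↦ (θ₁, …, θ_d, 0)`. -/
def augment (d : ℕ) : (Fin d → ℝ) →L[ℝ] (Fin (d + 1) → ℝ) :=
  ContinuousLinearMap.pi fun i =>
    Fin.lastCases (motive := fun _ => (Fin d → ℝ) →L[ℝ] ℝ) 0
      (fun j => ContinuousLinearMap.proj (R := ℝ) (φ := fun _ : Fin d => ℝ) j) i

@[simp] theorem augment_castSucc (θ : Fin d → ℝ) (i : Fin d) :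
    augment d θ i.castSucc = θ i := by
  simp [augment]

@[simp] theorem augment_last (θ : Fin d → ℝ) : augment d θ (Fin.last d) = 0 := by
  simp [augment]

/-- Logarithmic coordinates on the simplex: `θᵢ = log (pᵢ / p_n)`. -/
def logParam (θ : Fin d → ℝ) : Fin (d + 1) → ℝ := softmax (augment d θ)

/-- The map `logParam` in the coordinates `(p₁, …, p_{n-1})`. -/
def expCoord (θ : Fin d → ℝ) : Fin d → ℝ :=
  fun i => Real.exp (θ i) / (1 + ∑ j, Real.exp (θ j))

/-- The inverse of `expCoord`. -/
def logRatio (p : Fin d → ℝ) : Fin d → ℝ :=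
  fun i => Real.log (p i) - Real.log (1 - ∑ j, p j)

theorem one_add_sum_exp_pos (θ : Fin d → ℝ) : 0 < 1 + ∑ j, Real.exp (θ j) :=
  add_pos_of_pos_of_nonneg one_pos (Finset.sum_nonneg fun _ _ => (Real.exp_pos _).le)

theorem chart_castSucc (x : Fin d → ℝ) (i : Fin d) : chart (d + 1) x i.castSucc = x i := by
  simp [chart]

theorem chart_last (x : Fin d → ℝ) : chart (d + 1) x (Fin.last d) = 1 - ∑ j, x j := by
  simp [chart]

theorem sum_exp_augment (θ : Fin d → ℝ) :
    ∑ j, Real.exp (augment d θ j) = 1 + ∑ j, Real.exp (θ j) := by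
  rw [Fin.sum_univ_castSucc]
  simp [add_comm]

theorem one_sub_sum_expCoord (θ : Fin d → ℝ) :
    1 - ∑ i, expCoord θ i = 1 / (1 + ∑ j, Real.exp (θ j)) := by
  have := one_add_sum_exp_pos θ
  simp only [expCoord, ← Finset.sum_div]
  field_simp
  ring

theorem expCoord_mem (θ : Fin d → ℝ) : expCoord θ ∈ coordDomain (d + 1) := by
  have := one_add_sum_exp_pos θ
  refine ⟨fun i => div_pos (Real.exp_pos _) this, ?_⟩
  have h := one_sub_sum_expCoord θ
  have h' : 0 < 1 / (1 + ∑ j, Real.exp (θ j)) := by positivity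
  change ∑ i, expCoord θ i < 1
  linarith

theorem chart_expCoord (θ : Fin d → ℝ) : chart (d + 1) (expCoord θ) = logParam θ := by
  ext i
  refine Fin.lastCases ?_ (fun j => ?_) i
  · rw [chart_last, one_sub_sum_expCoord, logParam, softmax, sum_exp_augment]
    simp
  · rw [chart_castSucc, logParam, softmax, sum_exp_augment]
    simp [expCoord]

theorem logRatio_expCoord (θ : Fin d → ℝ) : logRatio (expCoord θ) = θ := by
  ext i
  have := one_add_sum_exp_pos θ
  rw [logRatio, one_sub_sum_expCoord, expCoord, Real.log_div (Real.exp_pos _).ne' this.ne',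
    Real.log_div one_ne_zero this.ne', Real.log_exp, Real.log_one]
  ring

theorem expCoord_logRatio {p : Fin d → ℝ} (hp : p ∈ coordDomain (d + 1)) :
    expCoord (logRatio p) = p := by
  obtain ⟨h0, h1⟩ := hp
  change ∀ i : Fin d, 0 < p i at h0
  change ∑ i, p i < 1 at h1
  have hs : 0 < 1 - ∑ j, p j := by linarith
  have he : ∀ i, Real.exp (logRatio p i) = p i / (1 - ∑ j, p j) := fun i => by
    rw [logRatio, Real.exp_sub, Real.exp_log (h0 i), Real.exp_log hs]
  ext i
  simp only [expCoord, he, ← Finset.sum_div]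
  field_simp
  ring

theorem expCoord_injective : Function.Injective (expCoord (d := d)) :=
  Function.LeftInverse.injective logRatio_expCoord

theorem range_expCoord : Set.range (expCoord (d := d)) = coordDomain (d + 1) := by
  ext p
  constructor
  · rintro ⟨θ, rfl⟩
    exact expCoord_mem θ
  · intro hp
    exact ⟨logRatio p, expCoord_logRatio hp⟩

theorem logParam_mem (θ : Fin d → ℝ) : logParam θ ∈ simplex (d + 1) := softmax_mem _

theorem chart_injective : Function.Injective (fun x : Fin d → ℝ => chart (d + 1) x) := by
  intro x y h
  ext i
  have := congrFun h i.castSucc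
  simpa only [chart_castSucc] using this

theorem logParam_injective : Function.Injective (logParam (d := d)) := by
  intro x y h
  rw [← chart_expCoord, ← chart_expCoord] at h
  exact expCoord_injective (chart_injective h)

theorem range_logParam : Set.range (logParam (d := d)) = simplex (d + 1) := by
  ext p
  constructor
  · rintro ⟨θ, rfl⟩
    exact logParam_mem θ
  · rintro ⟨hp, hs⟩
    rw [Fin.sum_univ_castSucc] at hs
    have hmem : (fun i : Fin d => p i.castSucc) ∈ coordDomain (d + 1) := by
      refine ⟨fun i => hp _, ?_⟩
      have := hp (Fin.last d)
      change ∑ i : Fin d, p i.castSucc < 1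
      linarith
    refine ⟨logRatio fun i => p i.castSucc, ?_⟩
    rw [← chart_expCoord, expCoord_logRatio hmem]
    ext i
    refine Fin.lastCases ?_ (fun j => ?_) i
    · rw [chart_last]; linarith
    · rw [chart_castSucc]

theorem continuous_logParam : Continuous (logParam (d := d)) :=
  (contDiff_softmax (m := 0)).continuous.comp (augment d).continuous

theorem measurableEmbedding_logParam : MeasurableEmbedding (logParam (d := d)) :=
  continuous_logParam.measurableEmbedding logParam_injective

/-- A square matrix as a continuous linear map. -/
def matrixCLM (M : Matrix (Fin d) (Fin d) ℝ) : (Fin d → ℝ) →L[ℝ] (Fin d → ℝ) :=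
  LinearMap.toContinuousLinearMap (Matrix.toLin' M)

theorem matrixCLM_apply (M : Matrix (Fin d) (Fin d) ℝ) (v : Fin d → ℝ) :
    matrixCLM M v = M.mulVec v := by
  simp [matrixCLM]

theorem det_matrixCLM (M : Matrix (Fin d) (Fin d) ℝ) : (matrixCLM M).det = M.det := by
  simp [matrixCLM, ContinuousLinearMap.det]

theorem hasFDerivAt_expCoord (θ : Fin d → ℝ) :
    HasFDerivAt expCoord (matrixCLM (covMatrix (expCoord θ))) θ := by
  have hS := one_add_sum_exp_pos θ
  rw [hasFDerivAt_pi']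
  intro i
  have h1 : HasFDerivAt (fun x : Fin d → ℝ => Real.exp (x i)) _ θ :=
    (hasFDerivAt_apply i θ).exp
  have h2 : HasFDerivAt (fun x : Fin d → ℝ => 1 + ∑ j, Real.exp (x j)) _ θ :=
    (HasFDerivAt.fun_sum fun j _ => (hasFDerivAt_apply j θ).exp).const_add 1
  have heq : (fun x : Fin d → ℝ => expCoord x i) =
      fun x => Real.exp (x i) * (1 + ∑ j, Real.exp (x j))⁻¹ := by
    ext x; rw [expCoord, div_eq_mul_inv]
  rw [heq]
  have h3 : HasFDerivAt (fun x : Fin d → ℝ => (1 + ∑ j, Real.exp (x j))⁻¹) _ θ :=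
    (hasDerivAt_inv hS.ne').comp_hasFDerivAt θ h2
  refine (h1.fun_mul h3).congr_fderiv ?_
  ext v
  simp only [matrixCLM_apply, covMatrix, Matrix.sub_mulVec, Matrix.vecMulVec_mulVec,
    ContinuousLinearMap.comp_apply, ContinuousLinearMap.proj_apply, Pi.sub_apply,
    Matrix.mulVec_diagonal, dotProduct]
  simp [expCoord, div_mul_eq_mul_div, ← Finset.sum_div]
  field_simp
  ring

theorem hasFDerivAt_logRatio {p : Fin d → ℝ} (hp : ∀ i, 0 < p i) (hs : ∑ i, p i < 1) :
    HasFDerivAt logRatio (matrixCLM (covMatrixInv p)) p := by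
  have hS : 1 - ∑ i, p i ≠ 0 := by linarith
  rw [hasFDerivAt_pi']
  intro i
  have h1 : HasFDerivAt (fun x : Fin d → ℝ => Real.log (x i)) _ p :=
    (hasFDerivAt_apply i p).log (hp i).ne'
  have h2 : HasFDerivAt (fun x : Fin d → ℝ => Real.log (1 - ∑ j, x j)) _ p :=
    ((HasFDerivAt.fun_sum fun j _ => hasFDerivAt_apply j p).const_sub 1).log hS
  refine (h1.fun_sub h2).congr_fderiv ?_
  ext v
  simp only [matrixCLM_apply, covMatrixInv, Matrix.add_mulVec, ContinuousLinearMap.comp_apply,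
    ContinuousLinearMap.proj_apply, Pi.add_apply, Matrix.mulVec_diagonal]
  simp [Matrix.mulVec, dotProduct, ← Finset.mul_sum]

end Coordinates

/-! ### The reference measure and well-definedness of the entropy. -/

section ReferenceMeasure

variable {d : ℕ}

theorem measurable_chart : Measurable (fun x : Fin d → ℝ => chart (d + 1) x) := by
  rw [measurable_pi_iff]
  intro i
  refine Fin.lastCases ?_ (fun j => ?_) i
  · simp only [chart_last]; fun_prop
  · simp only [chart_castSucc]; fun_prop

/-- The Jacobian of the logarithmic parameterization is `p₁ ⋯ p_n`, the reciprocal of the density of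
`μ₀`. -/
theorem prod_logParam (θ : Fin d → ℝ) :
    ∏ i, logParam θ i = (covMatrix (expCoord θ)).det := by
  rw [det_covMatrix, ← chart_expCoord, Fin.prod_univ_castSucc]
  simp only [chart_castSucc, chart_last]

theorem lintegral_lebesgueSimplex {f : (Fin (d + 1) → ℝ) → ENNReal} (hf : Measurable f) :
    ∫⁻ p, f p ∂(lebesgueSimplex (d + 1)) =
      ∫⁻ θ : Fin d → ℝ, ENNReal.ofReal (∏ i, logParam θ i) * f (logParam θ) := by
  have h := lintegral_image_eq_lintegral_abs_det_fderiv_mul volume MeasurableSet.univ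
    (fun θ _ => (hasFDerivAt_expCoord (d := d) θ).hasFDerivWithinAt)
    expCoord_injective.injOn (fun x => f (chart (d + 1) x))
  rw [Set.image_univ, range_expCoord, setLIntegral_univ] at h
  rw [lebesgueSimplex, lintegral_map hf measurable_chart]
  refine h.trans (lintegral_congr fun θ => ?_)
  rw [det_matrixCLM, ← prod_logParam, chart_expCoord,
    abs_of_pos (Finset.prod_pos fun i _ => (logParam_mem θ).1 i)]

theorem measurable_prod_inv {n : ℕ} :
    Measurable fun p : Fin n → ℝ => ENNReal.ofReal (1 / ∏ i, p i) := by
  fun_prop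

/-- In logarithmic coordinates, the reference measure is Lebesgue measure. -/
theorem refMeasure_eq_map :
    refMeasure (d + 1) = (volume : Measure (Fin d → ℝ)).map logParam := by
  ext A hA
  rw [refMeasure, withDensity_apply _ hA, ← lintegral_indicator hA,
    lintegral_lebesgueSimplex (measurable_prod_inv.indicator hA),
    ← lintegral_indicator_one hA,
    lintegral_map (measurable_one.indicator hA) continuous_logParam.measurable]
  refine lintegral_congr fun θ => ?_
  have hpos : 0 < ∏ i, logParam θ i := Finset.prod_pos fun i _ => (logParam_mem θ).1 i
  by_cases h : logParam θ ∈ A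
  · rw [Set.indicator_of_mem h, Set.indicator_of_mem h, ← ENNReal.ofReal_mul hpos.le,
      mul_one_div_cancel hpos.ne', ENNReal.ofReal_one, Pi.one_apply]
  · rw [Set.indicator_of_notMem h, Set.indicator_of_notMem h, mul_zero]

instance sigmaFinite_refMeasure : SigmaFinite (refMeasure (d + 1)) := by
  rw [refMeasure_eq_map]
  exact measurableEmbedding_logParam.sigmaFinite_map

theorem volume_coordDomain_lt_top :
    (volume : Measure (Fin d → ℝ)) (coordDomain (d + 1)) < ⊤ := by
  have hsub : coordDomain (d + 1) ⊆ (Set.Icc 0 1 : Set (Fin d → ℝ)) := by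
    rintro x ⟨h0, h1⟩
    change ∀ i : Fin d, 0 < x i at h0
    change ∑ i : Fin d, x i < 1 at h1
    exact ⟨fun i => (h0 i).le, fun i =>
      (Finset.single_le_sum (fun j _ => (h0 j).le) (Finset.mem_univ i)).trans h1.le⟩
  exact (measure_mono hsub).trans_lt isCompact_Icc.measure_lt_top

theorem measurableSet_simplex : MeasurableSet (simplex (d + 1)) := by
  rw [← range_logParam]
  exact measurableEmbedding_logParam.measurableSet_range

theorem lebesgueSimplex_compl_simplex : lebesgueSimplex (d + 1) (simplex (d + 1))ᶜ = 0 := by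
  rw [← lintegral_indicator_one measurableSet_simplex.compl,
    lintegral_lebesgueSimplex (measurable_one.indicator measurableSet_simplex.compl)]
  simp [logParam_mem]

theorem lebesgueSimplex_absolutelyContinuous_refMeasure :
    lebesgueSimplex (d + 1) ≪ refMeasure (d + 1) := by
  refine withDensity_absolutelyContinuous' measurable_prod_inv.aemeasurable ?_
  filter_upwards [mem_ae_iff.mpr lebesgueSimplex_compl_simplex] with p hp
  have : 0 < ∏ i, p i := Finset.prod_pos fun i _ => hp.1 i
  simpa using this

theorem refMeasure_absolutelyContinuous_lebesgueSimplex {n : ℕ} :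
    refMeasure n ≪ lebesgueSimplex n :=
  withDensity_absolutelyContinuous _ _

theorem lintegral_prod_refMeasure_lt_top :
    ∫⁻ p, ENNReal.ofReal (∏ i, p i) ∂(refMeasure (d + 1)) < ⊤ := by
  have h1 := lintegral_lebesgueSimplex (d := d) (f := 1) measurable_one
  rw [refMeasure_eq_map, lintegral_map (by fun_prop) continuous_logParam.measurable]
  simp only [Pi.one_apply, mul_one] at h1
  rw [← h1, lintegral_one, lebesgueSimplex, Measure.map_apply (f := chart (d + 1)) measurable_chart
    MeasurableSet.univ]
  simpa using volume_coordDomain_lt_top (d := d)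

/-- The entropy of a measure with finite logarithmic moments is well defined. -/
theorem entNeg_lt_top {P : Measure (Fin (d + 1) → ℝ)} (hP : ClassL P)
    (hac : P ≪ refMeasure (d + 1)) : entNeg P < ⊤ := by
  have := hP.isProbabilityMeasure
  set ρ := P.rnDeriv (refMeasure (d + 1)) with hρ
  have hρm : Measurable ρ := Measure.measurable_rnDeriv _ _
  have hsimp : ∀ᵐ p ∂(refMeasure (d + 1)), p ∈ simplex (d + 1) :=
    mem_ae_iff.mpr (refMeasure_absolutelyContinuous_lebesgueSimplex
      lebesgueSimplex_compl_simplex)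
  -- With `w = ∏ pᵢ`, write `-x log x = x log (w / x) - x log w`. The first term is at most `w - x`
  -- by `log u ≤ u - 1`, and the second is controlled by the log moments. The function `w` is
  -- `μ₀`-integrable, its integral being the volume of the simplex.
  have hbound : entNeg P ≤ ∫⁻ p, (ENNReal.ofReal (∏ i, p i) +
      ρ p * ∑ i, ENNReal.ofReal |Real.log (p i)|) ∂(refMeasure (d + 1)) := by
    refine lintegral_mono_ae ?_
    filter_upwards [hsimp, Measure.rnDeriv_lt_top P (refMeasure (d + 1))] with p hp hfin
    set x := (ρ p).toReal with hx
    have hx0 : 0 ≤ x := ENNReal.toReal_nonneg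
    have hρx : ρ p = ENNReal.ofReal x := (ENNReal.ofReal_toReal hfin.ne).symm
    have hw : 0 < ∏ i, p i := Finset.prod_pos fun i _ => hp.1 i
    rw [hρx, ← ENNReal.ofReal_sum_of_nonneg fun i _ => abs_nonneg _, ← ENNReal.ofReal_mul hx0,
      ← ENNReal.ofReal_add hw.le (mul_nonneg hx0 (Finset.sum_nonneg fun i _ => abs_nonneg _))]
    refine ENNReal.ofReal_le_ofReal ?_
    change -(x * Real.log x) ≤ _
    have hlog : -Real.log (∏ i, p i) ≤ ∑ i, |Real.log (p i)| := by
      rw [Real.log_prod fun i _ => (hp.1 i).ne', ← Finset.sum_neg_distrib]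
      exact Finset.sum_le_sum fun i _ => neg_le_abs _
    rcases hx0.eq_or_lt with h0 | h0
    · rw [← h0]; simpa using hw.le
    · have h1 := Real.log_le_sub_one_of_pos (div_pos hw h0)
      rw [Real.log_div hw.ne' h0.ne'] at h1
      have h2 := mul_le_mul_of_nonneg_left h1 h0.le
      have h3 : x * ((∏ i, p i) / x - 1) = ∏ i, p i - x := by field_simp
      have h4 := mul_le_mul_of_nonneg_left hlog h0.le
      linarith
  refine hbound.trans_lt ?_
  rw [lintegral_add_left (by fun_prop), ENNReal.add_lt_top]
  refine ⟨lintegral_prod_refMeasure_lt_top, ?_⟩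
  have hm : ∀ i, Measurable fun p : Fin (d + 1) → ℝ => ENNReal.ofReal |Real.log (p i)| :=
    fun i => by fun_prop
  rw [lintegral_rnDeriv_mul hac (Finset.measurable_fun_sum _ fun i _ => hm i).aemeasurable,
    lintegral_finsetSum _ fun i _ => hm i]
  exact hP.logMoment

end ReferenceMeasure

/-! ### The potential, its gradient and Hessian, and strict exponential concavity. -/

section Potential

variable {n : ℕ}

/-- The function generating the portfolio map in logarithmic coordinates. -/
def potential (φ : (Fin n → ℝ) → ℝ) (y : Fin n → ℝ) : ℝ :=
  φ (softmax y) + Real.log (∑ j, Real.exp (y j))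

/-- The gradient of `potential φ`. -/
def weight (φ : (Fin n → ℝ) → ℝ) (y : Fin n → ℝ) : Fin n → ℝ :=
  fun i => fderiv ℝ (potential φ) y (Pi.single i 1)

/-- The Hessian of `potential φ`. -/
def hessian (φ : (Fin n → ℝ) → ℝ) (y : Fin n → ℝ) : (Fin n → ℝ) →L[ℝ] (Fin n → ℝ) →L[ℝ] ℝ :=
  fderiv ℝ (fderiv ℝ (potential φ)) y

variable {φ : (Fin n → ℝ) → ℝ}

theorem fderiv_potential_apply (y v : Fin n → ℝ) :
    fderiv ℝ (potential φ) y v = ∑ i, weight φ y i * v i := by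
  conv_lhs => rw [pi_eq_sum_univ' v]
  simp only [map_sum, map_smul, smul_eq_mul]
  refine Finset.sum_congr rfl fun i _ => ?_
  rw [mul_comm]
  congr 2

/-- Precomposition with softmax gives a function smooth on all of `ℝⁿ`, so full derivatives are
available although `φ` is controlled only on the simplex, which is not open. -/
theorem contDiff_potential [NeZero n] (h : ContDiffOn ℝ 2 φ (simplex n)) :
    ContDiff ℝ 2 (potential φ) :=
  (h.comp_contDiff contDiff_softmax softmax_mem).add
    (ContDiff.log (by fun_prop) fun y => (sum_exp_pos y).ne')

theorem potential_add_const [NeZero n] (y : Fin n → ℝ) (c : ℝ) :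
    potential φ (fun i => y i + c) = potential φ y + c := by
  have := sum_exp_pos y
  simp only [potential, softmax_add_const, Real.exp_add, ← Finset.sum_mul]
  rw [Real.log_mul this.ne' (Real.exp_pos c).ne', Real.log_exp, add_assoc]

theorem potential_log {r : Fin n → ℝ} (hr : r ∈ simplex n) :
    potential φ (fun i => Real.log (r i)) = φ r := by
  simp only [potential, softmax_log hr, Real.exp_log (hr.1 _), hr.2, Real.log_one, add_zero]

theorem fderiv_potential_add_const [NeZero n] (y : Fin n → ℝ) (c : ℝ) :
    fderiv ℝ (potential φ) (fun i => y i + c) = fderiv ℝ (potential φ) y := by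
  have h1 : (fun x : Fin n → ℝ => potential φ (x + fun _ => c)) = fun x => potential φ x + c :=
    funext fun x => potential_add_const x c
  have h2 := fderiv_comp_add_right (𝕜 := ℝ) (f := potential φ) (x := y) (fun _ => c)
  rw [h1, fderiv_add_const] at h2
  exact h2.symm

theorem weight_add_const [NeZero n] (y : Fin n → ℝ) (c : ℝ) :
    weight φ (fun i => y i + c) = weight φ y := by
  ext i
  rw [weight, fderiv_potential_add_const, weight]

theorem hessian_add_const [NeZero n] (y : Fin n → ℝ) (c : ℝ) :
    hessian φ (fun i => y i + c) = hessian φ y := by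
  have h1 : (fun x : Fin n → ℝ => fderiv ℝ (potential φ) (x + fun _ => c)) =
      fderiv ℝ (potential φ) :=
    funext fun x => fderiv_potential_add_const x c
  have h2 := fderiv_comp_add_right (𝕜 := ℝ) (f := fderiv ℝ (potential φ)) (x := y) (fun _ => c)
  rw [h1] at h2
  exact h2.symm

theorem fderiv_potential_const [NeZero n] (h : ContDiffOn ℝ 2 φ (simplex n)) (y : Fin n → ℝ)
    (c : ℝ) : fderiv ℝ (potential φ) y (fun _ => c) = c := by
  have hd := ((contDiff_potential h).differentiable two_ne_zero y).hasFDerivAt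
  have h1 : HasDerivAt (fun s : ℝ => potential φ (y + s • fun _ => c)) _ 0 :=
    hd.hasLineDerivAt (fun _ => c)
  have h2 : (fun s : ℝ => potential φ (y + s • fun _ => c)) = fun s => potential φ y + s * c :=
    funext fun s => potential_add_const y (s * c)
  rw [h2] at h1
  have h3 : HasDerivAt (fun s : ℝ => potential φ y + s * c) c 0 := by
    simpa using ((hasDerivAt_id (0 : ℝ)).mul_const c).const_add (potential φ y)
  exact h1.unique h3

theorem sum_weight [NeZero n] (h : ContDiffOn ℝ 2 φ (simplex n)) (y : Fin n → ℝ) :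
    ∑ i, weight φ y i = 1 := by
  have := fderiv_potential_const h y 1
  rw [fderiv_potential_apply] at this
  simpa using this

theorem hasFDerivAt_fderiv_potential [NeZero n] (h : ContDiffOn ℝ 2 φ (simplex n))
    (y : Fin n → ℝ) : HasFDerivAt (fderiv ℝ (potential φ)) (hessian φ y) y :=
  (((contDiff_potential h).fderiv_right (m := 1) (by norm_num)).differentiable one_ne_zero
    y).hasFDerivAt

theorem hessian_symm [NeZero n] (h : ContDiffOn ℝ 2 φ (simplex n)) (y v w : Fin n → ℝ) :
    hessian φ y v w = hessian φ y w v :=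
  ((contDiff_potential h).contDiffAt.isSymmSndFDerivAt (by simp)) v w

theorem hessian_apply_const [NeZero n] (h : ContDiffOn ℝ 2 φ (simplex n)) (y v : Fin n → ℝ)
    (c : ℝ) : hessian φ y v (fun _ => c) = 0 := by
  have h1 := (hasFDerivAt_fderiv_potential h y).clm_apply
    (hasFDerivAt_const (fun _ => c : Fin n → ℝ) y)
  have h2 : (fun x => fderiv ℝ (potential φ) x (fun _ => c)) = fun _ => c :=
    funext fun x => fderiv_potential_const h x c
  rw [h2] at h1
  have h3 := congrArg (fun L => L v) (h1.unique (hasFDerivAt_const c y))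
  simpa using h3

theorem hessian_sub_const [NeZero n] (h : ContDiffOn ℝ 2 φ (simplex n)) (y w : Fin n → ℝ)
    (c : ℝ) : hessian φ y (w - fun _ => c) (w - fun _ => c) = hessian φ y w w := by
  rw [map_sub, hessian_apply_const h, hessian_symm h, map_sub, hessian_apply_const h]
  simp

theorem hasDerivAt_log_line {r v : Fin n → ℝ} {h : ℝ} (hr : ∀ i, 0 < r i + h * v i) :
    HasDerivAt (fun s : ℝ => fun i => Real.log (r i + s * v i))
      (fun i => v i / (r i + h * v i)) h := by
  rw [hasDerivAt_pi]
  intro i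
  have : HasDerivAt (fun s : ℝ => r i + s * v i) (v i) h := by
    simpa using ((hasDerivAt_id h).mul_const (v i)).const_add (r i)
  exact this.log (hr i).ne'

theorem eventually_mem_simplex {r v : Fin n → ℝ} {h : ℝ} (hr : r + h • v ∈ simplex n)
    (hv : ∑ i, v i = 0) : ∀ᶠ s : ℝ in nhds h, r + s • v ∈ simplex n := by
  have h1 : ∀ᶠ s : ℝ in nhds h, ∀ i, 0 < (r + s • v) i := by
    rw [Filter.eventually_all]
    intro i
    have hc : Continuous fun s : ℝ => (r + s • v) i := by
      simp only [Pi.add_apply, Pi.smul_apply]; fun_prop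
    exact hc.continuousAt.eventually (lt_mem_nhds (hr.1 i))
  filter_upwards [h1] with s hs
  refine ⟨hs, ?_⟩
  have := hr.2
  simp only [Pi.add_apply, Pi.smul_apply, smul_eq_mul, Finset.sum_add_distrib, ← Finset.mul_sum,
    hv, mul_zero] at this ⊢
  exact this

/-- Inside the simplex `φ(r) = Φ(log r)`, so the chain rule expresses derivatives of `φ` in tangent
directions through those of the potential. -/
theorem hasDerivAt_line [NeZero n] (hφ : ContDiffOn ℝ 2 φ (simplex n)) {r v : Fin n → ℝ} {h : ℝ}
    (hr : r + h • v ∈ simplex n) (hv : ∑ i, v i = 0) :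
    HasDerivAt (fun s : ℝ => φ (r + s • v))
      (fderiv ℝ (potential φ) (fun i => Real.log (r i + h * v i))
        (fun i => v i / (r i + h * v i))) h := by
  have hd := ((contDiff_potential hφ).differentiable two_ne_zero
    (fun i => Real.log (r i + h * v i))).hasFDerivAt
  have h1 := hd.comp_hasDerivAt h (hasDerivAt_log_line (r := r) (v := v) (h := h) hr.1)
  refine h1.congr_of_eventuallyEq ?_
  filter_upwards [eventually_mem_simplex hr hv] with s hs
  exact (potential_log hs).symm

theorem hasDerivAt_deriv_line [NeZero n] (hφ : ContDiffOn ℝ 2 φ (simplex n)) {r v : Fin n → ℝ}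
    {h : ℝ} (hr : ∀ i, 0 < r i + h * v i) :
    HasDerivAt (fun s : ℝ => fderiv ℝ (potential φ) (fun i => Real.log (r i + s * v i))
        (fun i => v i / (r i + s * v i)))
      (hessian φ (fun i => Real.log (r i + h * v i)) (fun i => v i / (r i + h * v i))
          (fun i => v i / (r i + h * v i)) -
        fderiv ℝ (potential φ) (fun i => Real.log (r i + h * v i))
          (fun i => (v i / (r i + h * v i)) ^ 2)) h := by
  have h1 := (hasFDerivAt_fderiv_potential hφ
    (fun i => Real.log (r i + h * v i))).comp_hasDerivAt h (hasDerivAt_log_line hr)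
  have h2 : HasDerivAt (fun s : ℝ => fun i => v i / (r i + s * v i))
      (-fun i => (v i / (r i + h * v i)) ^ 2) h := by
    rw [hasDerivAt_pi]
    intro i
    have h3 : HasDerivAt (fun s : ℝ => r i + s * v i) (v i) h := by
      simpa using ((hasDerivAt_id h).mul_const (v i)).const_add (r i)
    have h4 := (hasDerivAt_const h (v i)).fun_div h3 (hr i).ne'
    refine h4.congr_deriv ?_
    simp only [Pi.neg_apply]
    have := (hr i).ne'
    field_simp
    ring
  have h5 := h1.clm_apply h2
  refine h5.congr_deriv ?_
  simp [sub_eq_add_neg]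

theorem lineDeriv_eq [NeZero n] (hφ : ContDiffOn ℝ 2 φ (simplex n)) {r v : Fin n → ℝ}
    (hr : r ∈ simplex n) (hv : ∑ i, v i = 0) :
    lineDeriv ℝ φ r v =
      ∑ i, weight φ (fun i => Real.log (r i)) i * (v i / r i) := by
  have h := hasDerivAt_line hφ (r := r) (v := v) (h := 0) (by simpa using hr) hv
  simp only [zero_mul, add_zero] at h
  rw [lineDeriv, h.deriv, fderiv_potential_apply]

/-- In logarithmic coordinates `L` is the variance of `v / r` under the portfolio weights minus the
Hessian of the potential: the square term comes from differentiating `v / (r + s v)`. -/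
theorem quadL_eq [NeZero n] (hφ : ContDiffOn ℝ 2 φ (simplex n)) {r v : Fin n → ℝ}
    (hr : r ∈ simplex n) (hv : ∑ i, v i = 0) :
    quadL φ r v =
      ∑ i, weight φ (fun i => Real.log (r i)) i * (v i / r i) ^ 2 -
      (∑ i, weight φ (fun i => Real.log (r i)) i * (v i / r i)) ^ 2 -
      hessian φ (fun i => Real.log (r i)) (fun i => v i / r i) (fun i => v i / r i) := by
  have hr0 : r + (0 : ℝ) • v ∈ simplex n := by simpa using hr
  have h1 : deriv (fun h : ℝ => φ (r + h • v)) =ᶠ[nhds 0] fun s : ℝ =>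
      fderiv ℝ (potential φ) (fun i => Real.log (r i + s * v i))
        (fun i => v i / (r i + s * v i)) := by
    filter_upwards [eventually_mem_simplex hr0 hv] with s hs
    exact (hasDerivAt_line hφ hs hv).deriv
  have h2 := hasDerivAt_deriv_line hφ (r := r) (v := v) (h := 0) (by simpa using hr.1)
  simp only [zero_mul, add_zero] at h2
  rw [quadL, lineDeriv_eq hφ hr hv, iteratedDeriv_succ, iteratedDeriv_one, h1.deriv_eq, h2.deriv,
    fderiv_potential_apply]
  ring

theorem weight_log_softmax [NeZero n] (y : Fin n → ℝ) :
    weight φ (fun i => Real.log (softmax y i)) = weight φ y := by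
  simp only [log_softmax, sub_eq_add_neg]
  exact weight_add_const _ _

/-- Since the weights sum to `1`, the derivative towards `eᵢ` equals `wᵢ / rᵢ - 1`, and the
normalization of the portfolio map removes the `-1` and the `rᵢ`. -/
theorem portfolio_softmax [NeZero n] (hφ : ContDiffOn ℝ 2 φ (simplex n)) (y : Fin n → ℝ) :
    portfolio φ (softmax y) = weight φ y := by
  ext i
  have hr := softmax_mem y
  have hv : ∑ j, (Pi.single i (1 : ℝ) - softmax y : Fin n → ℝ) j = 0 := by
    simp [Finset.sum_sub_distrib, softmax_sum]
  rw [portfolio, lineDeriv_eq hφ hr hv, weight_log_softmax]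
  have h1 : ∀ j, weight φ y j * ((Pi.single i (1 : ℝ) - softmax y : Fin n → ℝ) j / softmax y j) =
      weight φ y j * ((Pi.single i (1 : ℝ) : Fin n → ℝ) j / softmax y j) - weight φ y j := by
    intro j
    have := (hr.1 j).ne'
    simp only [Pi.sub_apply]
    field_simp
  simp only [h1, Finset.sum_sub_distrib, sum_weight hφ]
  have h2 : ∑ j, weight φ y j * ((Pi.single i (1 : ℝ) : Fin n → ℝ) j / softmax y j) =
      weight φ y i / softmax y i := by
    rw [Finset.sum_eq_single i]
    · simp [div_eq_mul_inv]
    · intro j _ hj; simp [hj]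
    · simp
  rw [h2]
  have := (hr.1 i).ne'
  field_simp
  ring

/-- This is positivity of `L` without the tangency constraint. Both sides are unchanged when a
constant is added to `w`; subtracting the `r`-mean `s` makes `r (w - s)` tangent, and it is nonzero
unless `w` is constant. -/
theorem hessian_lt [NeZero n] (hφ : Regular φ) (y w : Fin n → ℝ) (hw : ¬ ∃ c, ∀ i, w i = c) :
    hessian φ y w w <
      ∑ i, weight φ y i * w i ^ 2 - (∑ i, weight φ y i * w i) ^ 2 := by
  set r := softmax y with hrdef
  have hr : r ∈ simplex n := softmax_mem y
  set s := ∑ i, r i * w i with hs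
  have hv : ∑ i, r i * (w i - s) = 0 := by
    simp only [mul_sub, Finset.sum_sub_distrib, ← Finset.sum_mul, hr.2, ← hs]
    ring
  have hv0 : (fun i => r i * (w i - s)) ≠ 0 := by
    intro h0
    refine hw ⟨s, fun i => ?_⟩
    have := congrFun h0 i
    simp only [Pi.zero_apply, mul_eq_zero, (hr.1 i).ne', false_or] at this
    linarith
  have hq := hφ.posDef r hr (fun i => r i * (w i - s)) hv hv0
  rw [quadL_eq hφ.contDiffOn hr hv] at hq
  have hdiv : ∀ i, r i * (w i - s) / r i = w i - s := fun i =>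
    mul_div_cancel_left₀ _ (hr.1 i).ne'
  have hhess : hessian φ (fun i => Real.log (r i)) = hessian φ y := by
    simp only [hrdef, log_softmax, sub_eq_add_neg]
    exact hessian_add_const _ _
  have hweight : weight φ (fun i => Real.log (r i)) = weight φ y := weight_log_softmax y
  rw [hhess, hweight] at hq
  simp only [hdiv] at hq
  have h1 : hessian φ y (fun i => w i - s) (fun i => w i - s) = hessian φ y w w :=
    hessian_sub_const hφ.contDiffOn y w s
  have hsum := sum_weight hφ.contDiffOn y
  have h2 : ∑ i, weight φ y i * (w i - s) = ∑ i, weight φ y i * w i - s := by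
    simp only [mul_sub, Finset.sum_sub_distrib, ← Finset.sum_mul, hsum, one_mul]
  have h3 : ∑ i, weight φ y i * (w i - s) ^ 2 =
      ∑ i, weight φ y i * w i ^ 2 - 2 * s * ∑ i, weight φ y i * w i + s ^ 2 := by
    have : ∀ i, weight φ y i * (w i - s) ^ 2 = weight φ y i * w i ^ 2 -
      2 * s * (weight φ y i * w i) + weight φ y i * s ^ 2 := fun i => by ring
    simp only [this, Finset.sum_add_distrib, Finset.sum_sub_distrib, ← Finset.mul_sum,
      ← Finset.sum_mul, hsum, one_mul]
  rw [h1, h2, h3] at hq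
  nlinarith

/-- Strict concavity of `exp φ` along segments, at first order. -/
theorem exp_lt_of_ne [NeZero n] (hφ : Regular φ) {r r' : Fin n → ℝ} (hr : r ∈ simplex n)
    (hr' : r' ∈ simplex n) (hne : r ≠ r') :
    Real.exp (φ r') <
      Real.exp (φ r) * ∑ i, weight φ (fun i => Real.log (r i)) i * (r' i / r i) := by
  set v := r' - r with hvdef
  have hv : ∑ i, v i = 0 := by simp [hvdef, Finset.sum_sub_distrib, hr.2, hr'.2]
  have hmem : ∀ h ∈ Set.Icc (0 : ℝ) 1, r + h • v ∈ simplex n := by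
    rintro h ⟨h0, h1⟩
    refine ⟨fun i => ?_, ?_⟩
    · have e : (r + h • v) i = (1 - h) * r i + h * r' i := by
        simp [hvdef]; ring
      rw [e]
      rcases h0.eq_or_lt with rfl | h0
      · simpa using hr.1 i
      · have := mul_nonneg (sub_nonneg.mpr h1) (hr.1 i).le
        have := mul_pos h0 (hr'.1 i)
        linarith
    · simp [Finset.sum_add_distrib, ← Finset.mul_sum, hv, hr.2]
  set D : ℝ → ℝ := fun s => fderiv ℝ (potential φ) (fun i => Real.log (r i + s * v i))
    (fun i => v i / (r i + s * v i)) with hD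
  have hg : ∀ h ∈ Set.Icc (0 : ℝ) 1, HasDerivAt (fun s : ℝ => Real.exp (φ (r + s • v)))
      (Real.exp (φ (r + h • v)) * D h) h := fun h hh =>
    (hasDerivAt_line hφ.contDiffOn (hmem h hh) hv).exp
  -- Along the segment `g = exp φ` satisfies `g' = g D` and `g'' = g (D² + D')`. Here `D² + D'` is
  -- the Hessian minus the variance, negative by `hessian_lt`.
  have hg' : ∀ h ∈ Set.Icc (0 : ℝ) 1, ∃ g'' < 0,
      HasDerivAt (fun s : ℝ => Real.exp (φ (r + s • v)) * D s) g'' h := by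
    intro h hh
    refine ⟨_, ?_, (hg h hh).mul (hasDerivAt_deriv_line hφ.contDiffOn (hmem h hh).1)⟩
    set y : Fin n → ℝ := fun i => Real.log (r i + h * v i) with hy
    set w : Fin n → ℝ := fun i => v i / (r i + h * v i) with hw
    have hwc : ¬ ∃ c, ∀ i, w i = c := by
      rintro ⟨c, hc⟩
      have hpos : ∀ i, 0 < r i + h * v i := (hmem h hh).1
      -- A constant ratio would make `v` proportional to a point of the simplex; summing, `∑ vᵢ = 0`
      -- forces `c = 0` and hence `r = r'`.
      have hvi : ∀ i, v i = c * (r i + h * v i) := fun i => by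
        rw [← hc i]
        exact (div_mul_cancel₀ _ (hpos i).ne').symm
      have hc0 : c = 0 := by
        have e1 : ∑ i, c * (r i + h * v i) = 0 := by
          rw [← hv]; exact Finset.sum_congr rfl fun i _ => (hvi i).symm
        have e2 : ∑ i, (r i + h * v i) = 1 := (hmem h hh).2
        rw [← Finset.mul_sum, e2, mul_one] at e1
        exact e1
      refine hne (funext fun i => ?_)
      have := hvi i
      rw [hc0, zero_mul, hvdef, Pi.sub_apply] at this
      linarith
    have hlt := hessian_lt hφ y w hwc
    have e1 : D h = ∑ i, weight φ y i * w i := fderiv_potential_apply _ _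
    rw [fderiv_potential_apply y (fun i => w i ^ 2), e1]
    have := Real.exp_pos (φ (r + h • v))
    nlinarith
  have hanti : StrictAntiOn (fun s : ℝ => Real.exp (φ (r + s • v)) * D s) (Set.Icc 0 1) := by
    refine strictAntiOn_of_deriv_neg (convex_Icc 0 1) (fun h hh => ?_) fun h hh => ?_
    · obtain ⟨_, _, hd⟩ := hg' h hh
      exact hd.continuousAt.continuousWithinAt
    · rw [interior_Icc] at hh
      obtain ⟨_, hneg, hd⟩ := hg' h ⟨hh.1.le, hh.2.le⟩
      rwa [hd.deriv]
  -- The mean value theorem gives `g(1) - g(0) = g'(c)`, which is less than `g'(0)` as `g'`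
  -- decreases strictly.
  obtain ⟨c, hc, hcs⟩ := exists_hasDerivAt_eq_slope (fun s : ℝ => Real.exp (φ (r + s • v)))
    (fun s => Real.exp (φ (r + s • v)) * D s) one_pos
    (fun h hh => (hg h hh).continuousAt.continuousWithinAt)
    (fun h hh => hg h ⟨hh.1.le, hh.2.le⟩)
  have hlt := hanti (Set.left_mem_Icc.mpr zero_le_one) ⟨hc.1.le, hc.2.le⟩ hc.1
  have hD0 : D 0 = ∑ i, weight φ (fun i => Real.log (r i)) i * (r' i / r i) - 1 := by
    simp only [hD, zero_mul, add_zero]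
    rw [fderiv_potential_apply, ← sum_weight hφ.contDiffOn (fun i => Real.log (r i)),
      ← Finset.sum_sub_distrib]
    refine Finset.sum_congr rfl fun i _ => ?_
    have := (hr.1 i).ne'
    simp only [hvdef, Pi.sub_apply]
    field_simp
  have hr1 : r + v = r' := by simp [hvdef]
  simp only [hcs, zero_smul, add_zero, one_smul, hD0, hr1] at hlt
  linarith

/-- The fundamental inequality for the potential, in logarithmic coordinates. -/
theorem exp_potential_sub_lt [NeZero n] (hφ : Regular φ) {y y' : Fin n → ℝ}
    (hne : softmax y ≠ softmax y') :
    Real.exp (potential φ y' - potential φ y) <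
      ∑ i, weight φ y i * Real.exp (y' i - y i) := by
  have h := exp_lt_of_ne hφ (softmax_mem y) (softmax_mem y') hne
  rw [weight_log_softmax] at h
  have hS := sum_exp_pos y
  have hS' := sum_exp_pos y'
  have e : ∀ i, weight φ y i * Real.exp (y' i - y i) =
      weight φ y i * (softmax y' i / softmax y i) *
        ((∑ j, Real.exp (y' j)) / ∑ j, Real.exp (y j)) := fun i => by
    have := Real.exp_pos (y i)
    simp only [softmax, Real.exp_sub]
    field_simp
  simp only [e, ← Finset.sum_mul]
  have e2 : Real.exp (potential φ y' - potential φ y) =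
      Real.exp (φ (softmax y')) / Real.exp (φ (softmax y)) *
        ((∑ j, Real.exp (y' j)) / ∑ j, Real.exp (y j)) := by
    rw [potential, potential, Real.exp_sub, Real.exp_add, Real.exp_add, Real.exp_log hS,
      Real.exp_log hS', mul_div_mul_comm]
  rw [e2]
  refine mul_lt_mul_of_pos_right ?_ (div_pos hS' hS)
  rw [div_lt_iff₀ (Real.exp_pos _)]
  linarith

end Potential

/-! ### Positivity of the weights and the dual certificate of optimality. -/

section Weights

variable {n : ℕ} {φ : (Fin n → ℝ) → ℝ}

theorem sub_eq_sub_of_softmax_eq [NeZero n] {y y' : Fin n → ℝ} (h : softmax y = softmax y')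
    (i j : Fin n) : y i - y j = y' i - y' j := by
  have hi := log_softmax y i
  have hj := log_softmax y j
  rw [h, log_softmax] at hi hj
  linarith

/-- The fundamental inequality tested on a shift of one coordinate. Since `n ≥ 2`, such a shift
really moves the point of the simplex, so the inequality is strict. -/
theorem exp_potential_add_single_lt [NeZero n] (hn : 2 ≤ n) (hφ : Regular φ) (y : Fin n → ℝ)
    (i : Fin n) {M : ℝ} (hM : M ≠ 0) :
    Real.exp (potential φ (y + Pi.single i M) - potential φ y) <
      1 + weight φ y i * (Real.exp M - 1) := by
  obtain ⟨j, hj⟩ : ∃ j : Fin n, j ≠ i := by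
    have : Nontrivial (Fin n) := Fin.nontrivial_iff_two_le.mpr hn
    exact exists_ne i
  have hne : softmax y ≠ softmax (y + Pi.single i M) := fun h => by
    have := sub_eq_sub_of_softmax_eq h i j
    simp [hj] at this
    exact hM this
  refine (exp_potential_sub_lt hφ hne).trans_eq ?_
  have : ∀ k, weight φ y k * Real.exp ((y + Pi.single i M : Fin n → ℝ) k - y k) =
      weight φ y k + if k = i then weight φ y i * (Real.exp M - 1) else 0 := by
    intro k
    by_cases hk : k = i
    · subst hk; simp; ring
    · simp [hk]
  simp only [this, Finset.sum_add_distrib, sum_weight hφ.contDiffOn]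
  simp

theorem weight_nonneg [NeZero n] (hn : 2 ≤ n) (hφ : Regular φ) (y : Fin n → ℝ) (i : Fin n) :
    0 ≤ weight φ y i := by
  by_contra! h
  -- The shift `M` is chosen with `exp M - 1 = 1 / -wᵢ`, which makes the right-hand side exactly
  -- `0`, while the left-hand side is an exponential.
  have hpos : 0 < 1 / -weight φ y i := one_div_pos.mpr (neg_pos.mpr h)
  have hM : Real.log (1 + 1 / -weight φ y i) ≠ 0 :=
    (Real.log_pos (by linarith)).ne'
  have h1 := exp_potential_add_single_lt hn hφ y i hM
  rw [Real.exp_log (by linarith)] at h1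
  have h2 : weight φ y i * (1 + 1 / -weight φ y i - 1) = -1 := by
    have := h.ne
    field_simp
    ring
  rw [h2] at h1
  have := Real.exp_pos
    (potential φ (y + Pi.single i (Real.log (1 + 1 / -weight φ y i))) - potential φ y)
  linarith

/-- If `wᵢ` vanished at `y`, raising `yᵢ` by `1` would strictly lower the potential. Coming back by
`-1` would also strictly lower it, because the weight at the new point is nonnegative. -/
theorem weight_pos [NeZero n] (hn : 2 ≤ n) (hφ : Regular φ) (y : Fin n → ℝ) (i : Fin n) :
    0 < weight φ y i := by
  refine (weight_nonneg hn hφ y i).lt_of_ne' fun h0 => ?_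
  have h1 := exp_potential_add_single_lt hn hφ y i one_ne_zero
  have h2 := exp_potential_add_single_lt hn hφ (y + Pi.single i 1) i (neg_ne_zero.mpr one_ne_zero)
  have e : y + Pi.single i 1 + Pi.single i (-1) = y := by
    rw [add_assoc, ← Pi.single_add]; simp
  rw [e] at h2
  rw [h0, zero_mul, add_zero, Real.exp_lt_one_iff] at h1
  have h3 : weight φ (y + Pi.single i 1) i * (Real.exp (-1) - 1) ≤ 0 :=
    mul_nonpos_of_nonneg_of_nonpos (weight_nonneg hn hφ _ i)
      (sub_nonpos.mpr (Real.exp_le_one_iff.mpr (by norm_num)))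
  have h4 := Real.exp_lt_one_iff.mp (h2.trans_le (by linarith))
  linarith

/-- The interpolated weights, in logarithmic coordinates. -/
def weightAt (φ : (Fin n → ℝ) → ℝ) (t : ℝ) (y : Fin n → ℝ) : Fin n → ℝ :=
  (1 - t) • barycenter n + t • weight φ y

theorem portfolioAt_softmax [NeZero n] (hφ : ContDiffOn ℝ 2 φ (simplex n)) (t : ℝ)
    (y : Fin n → ℝ) : portfolioAt φ t (softmax y) = weightAt φ t y := by
  rw [portfolioAt, portfolio_softmax hφ, weightAt]

theorem weightAt_pos [NeZero n] (hn : 2 ≤ n) (hφ : Regular φ) {t : ℝ} (ht : t ∈ Set.Icc (0 : ℝ) 1)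
    (y : Fin n → ℝ) (i : Fin n) : 0 < weightAt φ t y i := by
  have hn' : (0 : ℝ) < n := by exact_mod_cast (by omega : 0 < n)
  have hw := weight_pos hn hφ y i
  have hb : (0 : ℝ) < 1 / n := by positivity
  simp only [weightAt, barycenter, Pi.add_apply, Pi.smul_apply, smul_eq_mul]
  rcases ht.1.eq_or_lt with h0 | h0
  · rw [← h0]; simpa using hn'
  · have := mul_nonneg (sub_nonneg.mpr ht.2) hb.le
    have := mul_pos h0 hw
    linarith

theorem sum_weightAt [NeZero n] (hφ : ContDiffOn ℝ 2 φ (simplex n)) (t : ℝ)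
    (y : Fin n → ℝ) : ∑ i, weightAt φ t y i = 1 := by
  have hn' : (n : ℝ) ≠ 0 := by exact_mod_cast NeZero.ne n
  simp only [weightAt, barycenter, Pi.add_apply, Pi.smul_apply, smul_eq_mul,
    Finset.sum_add_distrib, ← Finset.mul_sum, sum_weight hφ]
  simp [hn']

/-- Jensen's inequality for `exp`. It expresses nonnegativity of the cost, and serves again for the
barycenter part of `π_t` in the dual certificate. -/
theorem mean_le_log_mean_exp [NeZero n] (z : Fin n → ℝ) :
    1 / (n : ℝ) * ∑ i, z i ≤ Real.log (1 / (n : ℝ) * ∑ i, Real.exp (z i)) := by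
  have hn' : (n : ℝ) ≠ 0 := by exact_mod_cast NeZero.ne n
  have hn0 : (0 : ℝ) < n := by exact_mod_cast Nat.pos_of_ne_zero (NeZero.ne n)
  have h := convexOn_exp.map_sum_le (t := Finset.univ) (w := fun _ : Fin n => 1 / (n : ℝ))
    (p := z) (fun _ _ => by positivity) (by simp [hn']) (fun _ _ => Set.mem_univ _)
  simp only [smul_eq_mul, ← Finset.mul_sum] at h
  have hpos := sum_exp_pos z
  rwa [Real.le_log_iff_exp_le (by positivity)]

theorem cost_softmax_nonneg [NeZero n] (a b : Fin n → ℝ) : 0 ≤ cost (softmax a) (softmax b) := by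
  rw [cost_softmax]
  linarith [mean_le_log_mean_exp fun i => b i - a i]

theorem potential_sub_le_log [NeZero n] (hφ : Regular φ) (y y' : Fin n → ℝ) :
    potential φ y' - potential φ y ≤ Real.log (∑ i, weight φ y i * Real.exp (y' i - y i)) ∧
    (softmax y ≠ softmax y' → potential φ y' - potential φ y <
      Real.log (∑ i, weight φ y i * Real.exp (y' i - y i))) := by
  have hlt : softmax y ≠ softmax y' → potential φ y' - potential φ y <
      Real.log (∑ i, weight φ y i * Real.exp (y' i - y i)) := fun hne => by
    have h := exp_potential_sub_lt hφ hne
    rwa [Real.lt_log_iff_exp_lt ((Real.exp_pos _).trans h)]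
  refine ⟨?_, hlt⟩
  by_cases hne : softmax y = softmax y'
  · have hc : ∀ i, y' i = y i + (y' 0 - y 0) := fun i => by
      have := sub_eq_sub_of_softmax_eq hne i 0
      linarith
    have hy' : y' = fun i => y i + (y' 0 - y 0) := funext hc
    have hd : ∀ i, y' i - y i = y' 0 - y 0 := fun i => by linarith [hc i]
    have h1 : potential φ y' - potential φ y = y' 0 - y 0 := by
      conv_lhs => rw [hy', potential_add_const]
      ring
    simp only [h1, hd, ← Finset.sum_mul, sum_weight hφ.contDiffOn, one_mul, Real.log_exp, le_refl]
  · exact (hlt hne).le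

/-- The dual potential of the transport problem. -/
def dualPotential (φ : (Fin n → ℝ) → ℝ) (a : Fin n → ℝ) : ℝ :=
  potential φ (fun i => -a i) + 1 / (n : ℝ) * ∑ i, a i

/-- The image of `softmax a` under the transport map. -/
def transported (φ : (Fin n → ℝ) → ℝ) (t : ℝ) (a : Fin n → ℝ) : Fin n → ℝ :=
  softmax fun i => a i + Real.log (weightAt φ t (fun i => -a i) i)

theorem transportMap_softmax [NeZero n] (hn : 2 ≤ n) (hφ : Regular φ) {t : ℝ}
    (ht : t ∈ Set.Icc (0 : ℝ) 1) (a : Fin n → ℝ) :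
    transportMap φ t (softmax a) = transported φ t a := by
  rw [transportMap, sinv_softmax, portfolioAt_softmax hφ.contDiffOn,
    odot_softmax _ _ (weightAt_pos hn hφ ht _), transported]

/-- The displacement is `log π_t`, so the log-sum term only sees `∑ π_{t,i} = 1` and contributes a
constant. -/
theorem cost_transported [NeZero n] (hn : 2 ≤ n) (hφ : Regular φ) {t : ℝ}
    (ht : t ∈ Set.Icc (0 : ℝ) 1) (a : Fin n → ℝ) :
    cost (softmax a) (transported φ t a) =
      -Real.log n - 1 / (n : ℝ) * ∑ i, Real.log (weightAt φ t (fun i => -a i) i) := by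
  have hw := weightAt_pos hn hφ ht (fun i => -a i)
  rw [transported, cost_softmax]
  simp only [add_sub_cancel_left, Real.exp_log (hw _), sum_weightAt hφ.contDiffOn]
  simp

theorem cost_transported_sub [NeZero n] (hn : 2 ≤ n) (hφ : Regular φ) {t : ℝ}
    (ht : t ∈ Set.Icc (0 : ℝ) 1) (a a' : Fin n → ℝ) :
    cost (softmax a') (transported φ t a) - cost (softmax a) (transported φ t a) =
      Real.log (∑ i, weightAt φ t (fun i => -a i) i * Real.exp (-a' i - -a i)) -
        1 / (n : ℝ) * ∑ i, (-a' i - -a i) := by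
  have hn0 : (0 : ℝ) < n := by exact_mod_cast Nat.pos_of_ne_zero (NeZero.ne n)
  have hw := weightAt_pos hn hφ ht (fun i => -a i)
  rw [cost_transported hn hφ ht, transported, cost_softmax]
  set w := weightAt φ t (fun i => -a i)
  have e : ∀ i, Real.exp (a i + Real.log (w i) - a' i) = w i * Real.exp (-a' i - -a i) :=
    fun i => by
      rw [show a i + Real.log (w i) - a' i = Real.log (w i) + (-a' i - -a i) by ring,
        Real.exp_add, Real.exp_log (hw i)]
  have e2 : ∀ i, a i + Real.log (w i) - a' i = Real.log (w i) + (-a' i - -a i) :=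
    fun i => by ring
  have hpos : 0 < ∑ i, w i * Real.exp (-a' i - -a i) :=
    Finset.sum_pos (fun i _ => mul_pos (hw i) (Real.exp_pos _)) Finset.univ_nonempty
  simp only [e]
  simp only [e2, Finset.sum_add_distrib]
  rw [Real.log_mul (by positivity) hpos.ne', Real.log_div one_ne_zero hn0.ne', Real.log_one]
  ring

/-- The transport maps are optimal: `dualPotential` witnesses cyclical monotonicity. -/
theorem dualPotential_sub_le [NeZero n] (hn : 2 ≤ n) (hφ : Regular φ) {t : ℝ}
    (ht : t ∈ Set.Icc (0 : ℝ) 1) (a a' : Fin n → ℝ) :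
    t * (dualPotential φ a' - dualPotential φ a) ≤
      cost (softmax a') (transported φ t a) - cost (softmax a) (transported φ t a) ∧
    (0 < t → softmax (fun i => -a i) ≠ softmax (fun i => -a' i) →
      t * (dualPotential φ a' - dualPotential φ a) <
      cost (softmax a') (transported φ t a) - cost (softmax a) (transported φ t a)) := by
  have hn0 : (0 : ℝ) < n := by exact_mod_cast Nat.pos_of_ne_zero (NeZero.ne n)
  rw [cost_transported_sub hn hφ ht]
  set y : Fin n → ℝ := fun i => -a i with hy
  set y' : Fin n → ℝ := fun i => -a' i with hy'
  have hA := sum_exp_pos (fun i => y' i - y i)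
  have hB : 0 < ∑ i, weight φ y i * Real.exp (y' i - y i) :=
    Finset.sum_pos (fun i _ => mul_pos (weight_pos hn hφ y i) (Real.exp_pos _))
      Finset.univ_nonempty
  -- The weights are a mixture, so by concavity of `log` the log-sum is at least the mixture of a
  -- uniform part, bounded below by Jensen, and a portfolio part, bounded below by the potential
  -- difference.
  have hsplit : ∑ i, weightAt φ t y i * Real.exp (-a' i - -a i) =
      (1 - t) * (1 / (n : ℝ) * ∑ i, Real.exp (y' i - y i)) +
        t * ∑ i, weight φ y i * Real.exp (y' i - y i) := by
    simp only [Finset.mul_sum, ← Finset.sum_add_distrib]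
    refine Finset.sum_congr rfl fun i _ => ?_
    simp only [weightAt, barycenter, Pi.add_apply, Pi.smul_apply, smul_eq_mul, hy, hy']
    ring
  have hlog := strictConcaveOn_log_Ioi.concaveOn.2
    (Set.mem_Ioi.mpr (show 0 < 1 / (n : ℝ) * ∑ i, Real.exp (y' i - y i) by positivity))
    (Set.mem_Ioi.mpr hB) (sub_nonneg.mpr ht.2) ht.1 (by ring)
  simp only [smul_eq_mul] at hlog
  rw [← hsplit] at hlog
  have hmean := mul_le_mul_of_nonneg_left (mean_le_log_mean_exp fun i => y' i - y i)
    (sub_nonneg.mpr ht.2)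
  obtain ⟨hle, hlt⟩ := potential_sub_le_log hφ y y'
  have hle' := mul_le_mul_of_nonneg_left hle ht.1
  have hdual : t * (dualPotential φ a' - dualPotential φ a) =
      t * (potential φ y' - potential φ y) - t * (1 / (n : ℝ) * ∑ i, (y' i - y i)) := by
    simp only [dualPotential, hy, hy', Finset.sum_sub_distrib, Finset.sum_neg_distrib]
    ring
  rw [hdual]
  change _ ≤ _ - 1 / (n : ℝ) * ∑ i, (y' i - y i) ∧
    (_ → _ → _ < _ - 1 / (n : ℝ) * ∑ i, (y' i - y i))
  refine ⟨by linarith, fun h0 hne => ?_⟩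
  have hlt' := mul_lt_mul_of_pos_left (hlt hne) h0
  linarith

end Weights

/-! ### The transport map in logarithmic coordinates and its Jacobian. -/

section LogMap

open Matrix

variable {d : ℕ} {φ : (Fin (d + 1) → ℝ) → ℝ}

/-- The first `d` interpolated weights, as functions of logarithmic coordinates. -/
def weightCoord (φ : (Fin (d + 1) → ℝ) → ℝ) (t : ℝ) (η : Fin d → ℝ) : Fin d → ℝ :=
  fun i => weightAt φ t (augment d η) i.castSucc

/-- The Hessian matrix of the potential in logarithmic coordinates. -/
def hessMatrix (φ : (Fin (d + 1) → ℝ) → ℝ) (η : Fin d → ℝ) : Matrix (Fin d) (Fin d) ℝ :=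
  Matrix.of fun i j => hessian φ (augment d η) (Pi.single j.castSucc 1) (Pi.single i.castSucc 1)

/-- The matrix whose determinant is, up to a factor, the Jacobian of the transport map. -/
def interpMatrix (φ : (Fin (d + 1) → ℝ) → ℝ) (t : ℝ) (η : Fin d → ℝ) :
    Matrix (Fin d) (Fin d) ℝ :=
  covMatrix (weightCoord φ t η) - t • hessMatrix φ η

/-- The transport map in logarithmic coordinates. -/
def logMap (φ : (Fin (d + 1) → ℝ) → ℝ) (t : ℝ) (θ : Fin d → ℝ) : Fin d → ℝ :=
  θ + logRatio (weightCoord φ t (-θ))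

/-- The Jacobian matrix of `logMap φ t`. -/
def jacobian (φ : (Fin (d + 1) → ℝ) → ℝ) (t : ℝ) (θ : Fin d → ℝ) : Matrix (Fin d) (Fin d) ℝ :=
  1 - covMatrixInv (weightCoord φ t (-θ)) * (t • hessMatrix φ (-θ))

theorem augment_eq_sum (v : Fin d → ℝ) :
    augment d v = ∑ j, v j • (Pi.single j.castSucc 1 : Fin (d + 1) → ℝ) := by
  ext i
  simp only [Finset.sum_apply, Pi.smul_apply, smul_eq_mul]
  refine Fin.lastCases ?_ (fun k => ?_) i
  · simp [(Fin.castSucc_lt_last _).ne']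
  · simp [Pi.single_apply]

theorem augment_neg (θ : Fin d → ℝ) : augment d (-θ) = fun i => -augment d θ i := by
  rw [map_neg]; rfl

theorem hessMatrix_mulVec (η v : Fin d → ℝ) (i : Fin d) :
    (hessMatrix φ η *ᵥ v) i =
      hessian φ (augment d η) (augment d v) (Pi.single i.castSucc 1) := by
  rw [augment_eq_sum v]
  simp [hessMatrix, Matrix.mulVec, dotProduct, mul_comm]

theorem dotProduct_hessMatrix_mulVec (η v : Fin d → ℝ) :
    v ⬝ᵥ (hessMatrix φ η *ᵥ v) = hessian φ (augment d η) (augment d v) (augment d v) := by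
  simp only [dotProduct, hessMatrix_mulVec]
  conv_rhs => arg 2; rw [augment_eq_sum v]
  rw [map_sum]
  simp

theorem hessMatrix_isHermitian (hφ : ContDiffOn ℝ 2 φ (simplex (d + 1))) (η : Fin d → ℝ) :
    (hessMatrix φ η).IsHermitian := by
  ext i j
  simp only [conjTranspose_apply, hessMatrix, Matrix.of_apply, star_trivial]
  exact hessian_symm hφ _ _ _

theorem weightCoord_pos (hd : 1 ≤ d) (hφ : Regular φ) {t : ℝ} (ht : t ∈ Set.Icc (0 : ℝ) 1)
    (η : Fin d → ℝ) (i : Fin d) : 0 < weightCoord φ t η i :=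
  weightAt_pos (by omega) hφ ht _ _

theorem one_sub_sum_weightCoord (hφ : ContDiffOn ℝ 2 φ (simplex (d + 1))) (t : ℝ)
    (η : Fin d → ℝ) :
    1 - ∑ i, weightCoord φ t η i = weightAt φ t (augment d η) (Fin.last d) := by
  have := sum_weightAt hφ t (augment d η)
  rw [Fin.sum_univ_castSucc] at this
  simp only [weightCoord]
  linarith

theorem sum_weightCoord_lt (hd : 1 ≤ d) (hφ : Regular φ) {t : ℝ} (ht : t ∈ Set.Icc (0 : ℝ) 1)
    (η : Fin d → ℝ) : ∑ i, weightCoord φ t η i < 1 := by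
  have h1 := one_sub_sum_weightCoord hφ.contDiffOn t η
  have h2 := weightAt_pos (by omega) hφ ht (augment d η) (Fin.last d)
  linarith

theorem det_covMatrix_weightCoord (hφ : ContDiffOn ℝ 2 φ (simplex (d + 1))) (t : ℝ)
    (η : Fin d → ℝ) :
    (covMatrix (weightCoord φ t η)).det = ∏ i, weightAt φ t (augment d η) i := by
  rw [det_covMatrix, one_sub_sum_weightCoord hφ, Fin.prod_univ_castSucc]
  rfl

theorem logParam_logMap (hφ : ContDiffOn ℝ 2 φ (simplex (d + 1))) (t : ℝ) (θ : Fin d → ℝ) :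
    logParam (logMap φ t θ) = transported φ t (augment d θ) := by
  rw [logParam, transported]
  set w := weightAt φ t (fun i => -augment d θ i) with hw
  -- Subtracting the last log-weight makes the last coordinate `0`, the normalization of `augment`.
  rw [← softmax_add_const (fun i => augment d θ i + Real.log (w i)) (-Real.log (w (Fin.last d)))]
  congr 1
  ext i
  refine Fin.lastCases ?_ (fun k => ?_) i
  · simp
  · rw [augment_castSucc, logMap, Pi.add_apply, logRatio, one_sub_sum_weightCoord hφ,
      weightCoord, augment_neg, ← hw, augment_castSucc]
    ring

theorem transportMap_logParam (hd : 1 ≤ d) (hφ : Regular φ) {t : ℝ}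
    (ht : t ∈ Set.Icc (0 : ℝ) 1) (θ : Fin d → ℝ) :
    transportMap φ t (logParam θ) = logParam (logMap φ t θ) := by
  rw [logParam_logMap hφ.contDiffOn, logParam, transportMap_softmax (by omega) hφ ht]

theorem hasFDerivAt_weightCoord (hφ : ContDiffOn ℝ 2 φ (simplex (d + 1))) (t : ℝ)
    (η : Fin d → ℝ) :
    HasFDerivAt (weightCoord φ t) (matrixCLM (t • hessMatrix φ η)) η := by
  rw [hasFDerivAt_pi']
  intro i
  have h1 : HasFDerivAt (fun x => fderiv ℝ (potential φ) (augment d x)) _ η :=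
    (hasFDerivAt_fderiv_potential hφ (augment d η)).comp η (augment d).hasFDerivAt
  have h2 := h1.clm_apply
    (hasFDerivAt_const (Pi.single i.castSucc 1 : Fin (d + 1) → ℝ) η)
  have h3 := (h2.const_mul t).const_add ((1 - t) * (1 / ((d + 1 : ℕ) : ℝ)))
  refine (h3.congr_fderiv ?_)
  ext v
  simp [matrixCLM_apply, Matrix.smul_mulVec, hessMatrix_mulVec]

theorem hasFDerivAt_logMap (hd : 1 ≤ d) (hφ : Regular φ) {t : ℝ} (ht : t ∈ Set.Icc (0 : ℝ) 1)
    (θ : Fin d → ℝ) : HasFDerivAt (logMap φ t) (matrixCLM (jacobian φ t θ)) θ := by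
  have h1 := (hasFDerivAt_logRatio (weightCoord_pos hd hφ ht (-θ))
    (sum_weightCoord_lt hd hφ ht (-θ)))
  have h2 := hasFDerivAt_weightCoord hφ.contDiffOn t (-θ)
  have h3 : HasFDerivAt (fun x : Fin d → ℝ => logRatio (weightCoord φ t (-x))) _ θ :=
    h1.comp (g := logRatio) (f := fun x : Fin d → ℝ => weightCoord φ t (-x)) θ
      (h2.comp (f := fun x : Fin d → ℝ => -x) θ (hasFDerivAt_id θ).fun_neg)
  refine ((hasFDerivAt_id θ).add h3).congr_fderiv ?_
  ext1 v
  simp [matrixCLM_apply, jacobian, sub_eq_add_neg,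
    Matrix.neg_mulVec, Matrix.add_mulVec]

theorem continuous_logMap (hd : 1 ≤ d) (hφ : Regular φ) {t : ℝ} (ht : t ∈ Set.Icc (0 : ℝ) 1) :
    Continuous (logMap φ t) :=
  continuous_iff_continuousAt.mpr fun θ => (hasFDerivAt_logMap hd hφ ht θ).continuousAt

theorem continuous_hessMatrix (hφ : ContDiffOn ℝ 2 φ (simplex (d + 1))) :
    Continuous (hessMatrix φ) := by
  have h1 : Continuous (hessian φ) :=
    ((contDiff_potential hφ).fderiv_right (m := 1) (by norm_num)).continuous_fderiv one_ne_zero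
  refine continuous_matrix fun i j => ?_
  have h2 : Continuous fun η => hessian φ (augment d η) := h1.comp (augment d).continuous
  exact (h2.clm_apply continuous_const).clm_apply continuous_const

theorem continuous_weightCoord (hφ : ContDiffOn ℝ 2 φ (simplex (d + 1))) (t : ℝ) :
    Continuous (weightCoord φ t) :=
  continuous_iff_continuousAt.mpr fun θ => (hasFDerivAt_weightCoord hφ t θ).continuousAt

theorem continuous_interpMatrix (hφ : ContDiffOn ℝ 2 φ (simplex (d + 1))) (t : ℝ) :
    Continuous (interpMatrix φ t) := by
  have hw := continuous_weightCoord hφ t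
  exact ((hw.matrix_diagonal).sub (hw.matrix_vecMulVec hw)).sub
    ((continuous_hessMatrix hφ).const_smul t)

/-- Clearing the inverse trades the nonsymmetric Jacobian for a symmetric matrix whose dependence on
`t` is concave. -/
theorem covMatrix_mul_jacobian (hd : 1 ≤ d) (hφ : Regular φ) {t : ℝ}
    (ht : t ∈ Set.Icc (0 : ℝ) 1) (θ : Fin d → ℝ) :
    covMatrix (weightCoord φ t (-θ)) * jacobian φ t θ = interpMatrix φ t (-θ) := by
  rw [jacobian, Matrix.mul_sub, Matrix.mul_one, ← Matrix.mul_assoc,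
    covMatrix_mul_covMatrixInv (weightCoord_pos hd hφ ht (-θ)) (sum_weightCoord_lt hd hφ ht (-θ)),
    Matrix.one_mul, interpMatrix]

/-- This is `hessian_lt` on vectors with last coordinate `0`: such a vector is constant only if it
is zero. -/
theorem interpMatrix_one_posDef (hφ : Regular φ) (η : Fin d → ℝ) :
    (interpMatrix φ 1 η).PosDef := by
  refine PosDef.of_dotProduct_mulVec_pos ?_ fun v hv => ?_
  · rw [interpMatrix, one_smul]
    exact (covMatrix_isHermitian _).sub (hessMatrix_isHermitian hφ.contDiffOn η)
  · rw [star_trivial, interpMatrix, one_smul, Matrix.sub_mulVec, dotProduct_sub,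
      dotProduct_covMatrix_mulVec, dotProduct_hessMatrix_mulVec]
    have hne : ¬ ∃ c, ∀ i, augment d v i = c := by
      rintro ⟨c, hc⟩
      have h0 := hc (Fin.last d)
      rw [augment_last] at h0
      refine hv (funext fun i => ?_)
      have := hc i.castSucc
      rw [augment_castSucc] at this
      rw [this, ← h0]; rfl
    have h := hessian_lt hφ (augment d η) (augment d v) hne
    rw [Fin.sum_univ_castSucc, Fin.sum_univ_castSucc] at h
    simp only [augment_castSucc, augment_last] at h
    have e : ∀ i, weightCoord φ 1 η i = weight φ (augment d η) i.castSucc := fun i => by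
      simp [weightCoord, weightAt]
    simp only [e]
    simp only [ne_eq, OfNat.ofNat_ne_zero, not_false_eq_true, zero_pow, mul_zero, add_zero] at h
    linarith

theorem weightCoord_affine (η : Fin d → ℝ) {s t a b : ℝ} (hab : a + b = 1) :
    weightCoord φ (a * s + b * t) η = a • weightCoord φ s η + b • weightCoord φ t η := by
  obtain rfl : b = 1 - a := by linarith
  ext i
  simp only [weightCoord, weightAt, Pi.add_apply, Pi.smul_apply, smul_eq_mul]
  ring

/-- Loewner concavity in `t`. The Hessian term is linear in `t`, so the only defect is the rank-one
matrix of `covMatrix_affine`. -/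
theorem interpMatrix_affine (η : Fin d → ℝ) {s t a b : ℝ} (ha : 0 ≤ a) (hb : 0 ≤ b)
    (hab : a + b = 1) : ∃ N : Matrix (Fin d) (Fin d) ℝ, N.PosSemidef ∧
      interpMatrix φ (a * s + b * t) η =
        a • interpMatrix φ s η + b • interpMatrix φ t η + N := by
  refine ⟨(a * b) • vecMulVec (weightCoord φ s η - weightCoord φ t η)
    (weightCoord φ s η - weightCoord φ t η), ?_, ?_⟩
  · have := posSemidef_vecMulVec_self_star (weightCoord φ s η - weightCoord φ t η)
    rw [star_trivial] at this
    exact this.smul (mul_nonneg ha hb)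
  · rw [interpMatrix, weightCoord_affine η hab, covMatrix_affine _ _ hab, interpMatrix,
      interpMatrix]
    module

theorem smul_add_smul_posDef {ι : Type*} [Fintype ι] {A B : Matrix ι ι ℝ} (hA : A.PosDef)
    (hB : B.PosDef) {a b : ℝ} (ha : 0 ≤ a) (hb : 0 ≤ b) (hab : a + b = 1) :
    (a • A + b • B).PosDef := by
  rcases ha.eq_or_lt with rfl | ha'
  · obtain rfl : b = 1 := by linarith
    simpa using hB
  · exact (hA.smul ha').add_posSemidef (hB.posSemidef.smul hb)

/-- The matrix at `t` dominates the chord between the two positive definite matrices at `0` and `1`.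
-/
theorem interpMatrix_posDef (hd : 1 ≤ d) (hφ : Regular φ) {t : ℝ} (ht : t ∈ Set.Icc (0 : ℝ) 1)
    (η : Fin d → ℝ) : (interpMatrix φ t η).PosDef := by
  have h0 : (interpMatrix φ 0 η).PosDef := by
    rw [interpMatrix, zero_smul, sub_zero]
    have h0mem : (0 : ℝ) ∈ Set.Icc (0 : ℝ) 1 := ⟨le_rfl, zero_le_one⟩
    exact covMatrix_posDef (weightCoord_pos hd hφ h0mem η) (sum_weightCoord_lt hd hφ h0mem η)
  obtain ⟨N, hN, e⟩ := interpMatrix_affine (φ := φ) η (s := 0) (t := 1) (sub_nonneg.mpr ht.2) ht.1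
    (sub_add_cancel 1 t)
  rw [mul_zero, zero_add, mul_one] at e
  rw [e]
  exact (smul_add_smul_posDef h0 (interpMatrix_one_posDef hφ η) (sub_nonneg.mpr ht.2) ht.1
    (sub_add_cancel 1 t)).add_posSemidef hN

theorem log_det_interpMatrix_concave (hd : 1 ≤ d) (hφ : Regular φ) {s t : ℝ}
    (hs : s ∈ Set.Icc (0 : ℝ) 1) (ht : t ∈ Set.Icc (0 : ℝ) 1) {a b : ℝ} (ha : 0 ≤ a) (hb : 0 ≤ b)
    (hab : a + b = 1) (η : Fin d → ℝ) :
    a * Real.log (interpMatrix φ s η).det + b * Real.log (interpMatrix φ t η).det ≤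
      Real.log (interpMatrix φ (a * s + b * t) η).det := by
  obtain ⟨N, hN, e⟩ := interpMatrix_affine (φ := φ) η (s := s) (t := t) ha hb hab
  have hA := interpMatrix_posDef hd hφ hs η
  have hB := interpMatrix_posDef hd hφ ht η
  have hAB := smul_add_smul_posDef hA hB ha hb hab
  rw [e]
  exact (log_det_concave hA hB ha hb hab).trans
    (Real.log_le_log hAB.det_pos (det_le_det_add hAB hN))

theorem det_jacobian_pos (hd : 1 ≤ d) (hφ : Regular φ) {t : ℝ} (ht : t ∈ Set.Icc (0 : ℝ) 1)
    (θ : Fin d → ℝ) : 0 < (jacobian φ t θ).det := by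
  have h1 := congrArg Matrix.det (covMatrix_mul_jacobian hd hφ ht θ)
  rw [det_mul] at h1
  have h2 := (covMatrix_posDef (weightCoord_pos hd hφ ht (-θ))
    (sum_weightCoord_lt hd hφ ht (-θ))).det_pos
  have h3 := (interpMatrix_posDef hd hφ ht (-θ)).det_pos
  rw [← h1] at h3
  exact pos_of_mul_pos_right h3 h2.le

/-- The Jacobian and the cost combine to a log-determinant. -/
theorem neg_log_det_jacobian_add_cost (hd : 1 ≤ d) (hφ : Regular φ) {t : ℝ}
    (ht : t ∈ Set.Icc (0 : ℝ) 1) (θ : Fin d → ℝ) :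
    -Real.log (jacobian φ t θ).det +
        ((d + 1 : ℕ) : ℝ) * cost (logParam θ) (logParam (logMap φ t θ)) =
      -Real.log (interpMatrix φ t (-θ)).det -
        ((d + 1 : ℕ) : ℝ) * Real.log ((d + 1 : ℕ) : ℝ) := by
  have hw := weightAt_pos (by omega) hφ ht (augment d (-θ))
  have hJ := det_jacobian_pos hd hφ ht θ
  rw [logParam_logMap hφ.contDiffOn, logParam, cost_transported (by omega) hφ ht, ← augment_neg,
    ← covMatrix_mul_jacobian hd hφ ht, det_mul, det_covMatrix_weightCoord hφ.contDiffOn,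
    Real.log_mul (Finset.prod_pos fun i _ => hw i).ne' hJ.ne',
    Real.log_prod fun i _ => (hw i).ne']
  have : ((d + 1 : ℕ) : ℝ) ≠ 0 := by positivity
  field_simp
  ring

theorem logMap_zero (θ : Fin d → ℝ) (hφ : ContDiffOn ℝ 2 φ (simplex (d + 1))) :
    logMap φ 0 θ = θ := by
  ext i
  rw [logMap, Pi.add_apply, logRatio, one_sub_sum_weightCoord hφ]
  simp [weightCoord, weightAt, barycenter]

theorem logMap_injective (hd : 1 ≤ d) (hφ : Regular φ) {t : ℝ} (ht : t ∈ Set.Icc (0 : ℝ) 1) :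
    Function.Injective (logMap φ t) := by
  intro θ θ' h
  rcases ht.1.eq_or_lt with h0 | h0
  · subst h0
    rwa [logMap_zero θ hφ.contDiffOn, logMap_zero θ' hφ.contDiffOn] at h
  by_contra hne
  have hq : transported φ t (augment d θ) = transported φ t (augment d θ') := by
    rw [← logParam_logMap hφ.contDiffOn, ← logParam_logMap hφ.contDiffOn, h]
  have hs : softmax (fun i => -augment d θ i) ≠ softmax (fun i => -augment d θ' i) := by
    rw [← augment_neg, ← augment_neg]
    intro hs
    exact hne (neg_injective (logParam_injective hs))
  -- If two points had the same image, the strict dual inequalities in the two directions would add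
  -- up to `0 < 0`.
  have h1 := (dualPotential_sub_le (by omega) hφ ht (augment d θ) (augment d θ')).2 h0 hs
  have h2 := (dualPotential_sub_le (by omega) hφ ht (augment d θ') (augment d θ)).2 h0 hs.symm
  rw [hq] at h1
  linarith

theorem measurableEmbedding_logMap (hd : 1 ≤ d) (hφ : Regular φ) {t : ℝ}
    (ht : t ∈ Set.Icc (0 : ℝ) 1) : MeasurableEmbedding (logMap φ t) :=
  (continuous_logMap hd hφ ht).measurableEmbedding (logMap_injective hd hφ ht)

end LogMap

/-! ### The interpolating measures: absolute continuity, moments and density. -/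

section Interpolation

variable {d : ℕ} {φ : (Fin (d + 1) → ℝ) → ℝ} {P : Measure (Fin (d + 1) → ℝ)} {t : ℝ}

/-- A measure on the simplex in logarithmic coordinates. -/
def pullback (P : Measure (Fin (d + 1) → ℝ)) : Measure (Fin d → ℝ) :=
  P.comap logParam

theorem map_pullback (hP : P (simplex (d + 1))ᶜ = 0) : (pullback P).map logParam = P := by
  rw [pullback, measurableEmbedding_logParam.map_comap, range_logParam]
  exact Measure.restrict_eq_self_of_ae_mem (mem_ae_iff.mpr hP)

theorem isProbabilityMeasure_pullback (hP : ClassL P) : IsProbabilityMeasure (pullback P) := by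
  have := hP.isProbabilityMeasure
  constructor
  have h := measure_univ (μ := P)
  rw [← map_pullback hP.carried,
    Measure.map_apply continuous_logParam.measurable MeasurableSet.univ] at h
  simpa using h

theorem absolutelyContinuous_refMeasure (hP : ClassLa P) : P ≪ refMeasure (d + 1) :=
  hP.absolutelyContinuous.trans lebesgueSimplex_absolutelyContinuous_refMeasure

theorem pullback_absolutelyContinuous (hP : ClassLa P) : pullback P ≪ volume := by
  refine Measure.AbsolutelyContinuous.mk fun A hA h0 => ?_
  rw [pullback, measurableEmbedding_logParam.comap_apply]
  refine absolutelyContinuous_refMeasure hP ?_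
  rw [refMeasure_eq_map, measurableEmbedding_logParam.map_apply,
    Set.preimage_image_eq _ logParam_injective, h0]

theorem continuous_logParam_logMap (hd : 1 ≤ d) (hφ : Regular φ) (ht : t ∈ Set.Icc (0 : ℝ) 1) :
    Continuous fun θ => logParam (logMap φ t θ) :=
  continuous_logParam.comp (continuous_logMap hd hφ ht)

theorem measurableEmbedding_logParam_logMap (hd : 1 ≤ d) (hφ : Regular φ)
    (ht : t ∈ Set.Icc (0 : ℝ) 1) :
    MeasurableEmbedding fun θ => logParam (logMap φ t θ) :=
  measurableEmbedding_logParam.comp (measurableEmbedding_logMap hd hφ ht)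

theorem interpolation_eq_map (hd : 1 ≤ d) (hφ : Regular φ) (ht : t ∈ Set.Icc (0 : ℝ) 1)
    (hP : P (simplex (d + 1))ᶜ = 0) :
    interpolation P φ t = (pullback P).map fun θ => logParam (logMap φ t θ) := by
  have hcomp : transportMap φ t ∘ logParam = fun θ => logParam (logMap φ t θ) :=
    funext fun θ => transportMap_logParam hd hφ ht θ
  -- Nothing is known of `φ` off the simplex, so measurability of the transport map is obtained only
  -- almost everywhere, through the parameterization.
  have hmeas : AEMeasurable (transportMap φ t) ((pullback P).map logParam) := by
    rw [measurableEmbedding_logParam.aemeasurable_map_iff, hcomp]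
    exact (continuous_logParam_logMap hd hφ ht).aemeasurable
  rw [interpolation]
  conv_lhs => rw [← map_pullback hP]
  rw [AEMeasurable.map_map_of_aemeasurable hmeas continuous_logParam.aemeasurable, hcomp]

theorem measurable_det_jacobian (hd : 1 ≤ d) (hφ : Regular φ) (ht : t ∈ Set.Icc (0 : ℝ) 1) :
    Measurable fun θ => (jacobian φ t θ).det := by
  have h : (fun θ => (jacobian φ t θ).det) = fun θ =>
      (interpMatrix φ t (-θ)).det / (covMatrix (weightCoord φ t (-θ))).det := by
    ext θ
    have hpos := (covMatrix_posDef (weightCoord_pos hd hφ ht (-θ))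
      (sum_weightCoord_lt hd hφ ht (-θ))).det_pos
    rw [← covMatrix_mul_jacobian hd hφ ht, Matrix.det_mul, mul_div_cancel_left₀ _ hpos.ne']
  rw [h]
  have h1 := ((continuous_interpMatrix hφ.contDiffOn t).comp
    (continuous_neg (G := Fin d → ℝ))).matrix_det
  have hw := (continuous_weightCoord hφ.contDiffOn t).comp (continuous_neg (G := Fin d → ℝ))
  have h2 : Continuous fun θ => (covMatrix (weightCoord φ t (-θ))).det :=
    ((hw.matrix_diagonal).sub (hw.matrix_vecMulVec hw)).matrix_det
  exact h1.measurable.div h2.measurable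

theorem setLIntegral_image_logMap (hd : 1 ≤ d) (hφ : Regular φ) (ht : t ∈ Set.Icc (0 : ℝ) 1)
    {B : Set (Fin d → ℝ)} (hB : MeasurableSet B) (g : (Fin d → ℝ) → ENNReal) :
    ∫⁻ θ in logMap φ t '' B, g θ =
      ∫⁻ θ in B, ENNReal.ofReal (jacobian φ t θ).det * g (logMap φ t θ) := by
  rw [lintegral_image_eq_lintegral_abs_det_fderiv_mul volume hB
    (fun θ _ => (hasFDerivAt_logMap hd hφ ht θ).hasFDerivWithinAt)
    (logMap_injective hd hφ ht).injOn]
  refine lintegral_congr fun θ => ?_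
  rw [det_matrixCLM, abs_of_pos (det_jacobian_pos hd hφ ht θ)]

/-- If `N` is null and `A` is its preimage, the area formula gives `∫_A det J = 0`. As `det J > 0`,
the set `A` is null. -/
theorem interpolation_absolutelyContinuous (hd : 1 ≤ d) (hφ : Regular φ)
    (ht : t ∈ Set.Icc (0 : ℝ) 1) (hP : ClassLa P) :
    interpolation P φ t ≪ refMeasure (d + 1) := by
  have hS := measurableEmbedding_logMap hd hφ ht
  have h1 : (pullback P).map (logMap φ t) ≪ volume := by
    refine Measure.AbsolutelyContinuous.mk fun N hN h0 => ?_
    rw [Measure.map_apply hS.measurable hN]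
    refine pullback_absolutelyContinuous hP ?_
    have hA : MeasurableSet (logMap φ t ⁻¹' N) := hS.measurable hN
    have h2 := setLIntegral_image_logMap hd hφ ht hA 1
    simp only [Pi.one_apply, mul_one, lintegral_one, Measure.restrict_apply_univ] at h2
    rw [measure_mono_null (Set.image_preimage_subset _ _) h0] at h2
    have h3 := (lintegral_eq_zero_iff
      (measurable_det_jacobian hd hφ ht).ennreal_ofReal).mp h2.symm
    rw [Filter.EventuallyEq, ae_restrict_iff' hA] at h3
    refine measure_mono_null (fun θ hθ => ?_) h3
    simp only [Set.mem_compl_iff, Set.mem_ofPred_eq, Classical.not_imp]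
    refine ⟨hθ, ?_⟩
    simpa using det_jacobian_pos hd hφ ht θ
  rw [interpolation_eq_map hd hφ ht hP.carried, refMeasure_eq_map]
  have h4 := h1.map continuous_logParam.measurable
  rwa [Measure.map_map continuous_logParam.measurable hS.measurable] at h4

/-- Coordinate `i` of the interpolated point is a weighted mean of the coordinates at `t = 0` and `t
= 1`, with weights proportional to `(1 - t) / n` and `t Z`. It lies between their minimum and `1`,
so its logarithm is controlled by theirs. -/
theorem abs_log_odot_le {n : ℕ} {p w : Fin n → ℝ} (hp : p ∈ simplex n) (hw : ∀ i, 0 < w i)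
    (ht : t ∈ Set.Icc (0 : ℝ) 1) (i : Fin n) :
    |Real.log (odot p ((1 - t) • barycenter n + t • w) i)| ≤
      |Real.log (p i)| + |Real.log (odot p w i)| := by
  have hn0 : 0 < n := Fin.pos i
  have hn : (0 : ℝ) < 1 / n := by positivity
  have : NeZero n := ⟨hn0.ne'⟩
  have hZ : 0 < ∑ j, p j * w j :=
    Finset.sum_pos (fun j _ => mul_pos (hp.1 j) (hw j)) Finset.univ_nonempty
  set Z := ∑ j, p j * w j with hZdef
  have hsum : ∑ j, p j * ((1 - t) • barycenter n + t • w) j = (1 - t) * (1 / n) + t * Z := by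
    have : ∀ j, p j * ((1 - t) • barycenter n + t • w) j =
        (1 - t) * (1 / n) * p j + t * (p j * w j) := fun j => by
      simp only [barycenter, Pi.add_apply, Pi.smul_apply, smul_eq_mul]; ring
    simp only [this, Finset.sum_add_distrib, ← Finset.mul_sum, hp.2, mul_one, ← hZdef]
  have ht' := sub_nonneg.mpr ht.2
  have hden : 0 < (1 - t) * (1 / n) + t * Z := by
    rcases ht.1.eq_or_lt with h0 | h0
    · rw [← h0]; simpa using hn0
    · have := mul_nonneg ht' hn.le
      have := mul_pos h0 hZ
      linarith
  set x := odot p ((1 - t) • barycenter n + t • w) i with hx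
  set z := odot p w i with hz
  have hzZ : z * Z = p i * w i := div_mul_cancel₀ _ hZ.ne'
  have hz0 : 0 < z := div_pos (mul_pos (hp.1 i) (hw i)) hZ
  have hp0 := hp.1 i
  have hxe : x * ((1 - t) * (1 / n) + t * Z) = (1 - t) * (1 / n) * p i + t * (z * Z) := by
    rw [hx, odot, hsum, div_mul_cancel₀ _ hden.ne', hzZ]
    simp only [barycenter, Pi.add_apply, Pi.smul_apply, smul_eq_mul]
    ring
  have hmin : min (p i) z ≤ x := by
    refine le_of_mul_le_mul_right ?_ hden
    rw [hxe, mul_add]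
    have h1 := mul_le_mul_of_nonneg_left (min_le_left (p i) z) (mul_nonneg ht' hn.le)
    have h2 := mul_le_mul_of_nonneg_left (min_le_right (p i) z) (mul_nonneg ht.1 hZ.le)
    linarith
  have hp1 : p i ≤ 1 := hp.2 ▸ Finset.single_le_sum (fun j _ => (hp.1 j).le) (Finset.mem_univ i)
  have hz1 : z ≤ 1 := by
    rw [hz, odot, div_le_one hZ]
    exact Finset.single_le_sum (f := fun j => p j * w j)
      (fun j _ => (mul_pos (hp.1 j) (hw j)).le) (Finset.mem_univ i)
  have hx1 : x ≤ 1 := by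
    refine le_of_mul_le_mul_right ?_ hden
    rw [hxe, one_mul]
    have h1 := mul_le_mul_of_nonneg_left hp1 (mul_nonneg ht' hn.le)
    have h2 := mul_le_mul_of_nonneg_left hz1 (mul_nonneg ht.1 hZ.le)
    linarith
  have hmin0 : 0 < min (p i) z := lt_min hp0 hz0
  have hlog := Real.log_le_log hmin0 hmin
  rw [abs_of_nonpos (Real.log_nonpos (hmin0.le.trans hmin) hx1),
    abs_of_nonpos (Real.log_nonpos hp0.le hp1), abs_of_nonpos (Real.log_nonpos hz0.le hz1)]
  have hlp := Real.log_nonpos hp0.le hp1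
  have hlz := Real.log_nonpos hz0.le hz1
  rcases min_choice (p i) z with h | h <;> rw [h] at hlog <;> linarith

theorem measurable_abs_log {n : ℕ} (i : Fin n) :
    Measurable fun p : Fin n → ℝ => ENNReal.ofReal |Real.log (p i)| := by
  fun_prop

theorem interpolation_classLa (hd : 1 ≤ d) (hφ : Regular φ) (ht : t ∈ Set.Icc (0 : ℝ) 1)
    (hP : ClassLa P) (hP₁ : ClassL (interpolation P φ 1)) : ClassLa (interpolation P φ t) := by
  have := isProbabilityMeasure_pullback hP.toClassL
  have hcont := continuous_logParam_logMap hd hφ ht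
  have h1mem : (1 : ℝ) ∈ Set.Icc (0 : ℝ) 1 := ⟨zero_le_one, le_rfl⟩
  have hcont1 := continuous_logParam_logMap hd hφ h1mem
  have hac := interpolation_absolutelyContinuous hd hφ ht hP
  have hfin0 := hP.logMoment
  have hfin1 := hP₁.logMoment
  rw [← map_pullback hP.carried] at hfin0
  rw [interpolation_eq_map hd hφ h1mem hP.carried] at hfin1
  simp only [lintegral_map (measurable_abs_log _) continuous_logParam.measurable] at hfin0
  simp only [lintegral_map (measurable_abs_log _) hcont1.measurable] at hfin1
  refine ⟨⟨?_, ?_, ?_⟩, hac.trans refMeasure_absolutelyContinuous_lebesgueSimplex⟩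
  · rw [interpolation_eq_map hd hφ ht hP.carried]
    exact Measure.isProbabilityMeasure_map hcont.aemeasurable
  · rw [interpolation_eq_map hd hφ ht hP.carried,
      Measure.map_apply hcont.measurable measurableSet_simplex.compl]
    simp [Set.preimage, logParam_mem]
  · rw [interpolation_eq_map hd hφ ht hP.carried]
    simp only [lintegral_map (measurable_abs_log _) hcont.measurable]
    refine lt_of_le_of_lt ?_ (ENNReal.add_lt_top.mpr ⟨hfin0, hfin1⟩)
    rw [← Finset.sum_add_distrib]
    refine Finset.sum_le_sum fun i _ => ?_
    have hm : Measurable fun θ : Fin d → ℝ => ENNReal.ofReal |Real.log (logParam θ i)| :=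
      (measurable_abs_log i).comp continuous_logParam.measurable
    rw [← lintegral_add_left hm]
    refine lintegral_mono fun θ => ?_
    rw [← ENNReal.ofReal_add (abs_nonneg _) (abs_nonneg _)]
    refine ENNReal.ofReal_le_ofReal ?_
    have hw := weight_pos (by omega) hφ (fun i => -augment d θ i)
    have h := abs_log_odot_le (logParam_mem θ) hw ht i
    have e : ∀ s, transportMap φ s (logParam θ) =
        odot (logParam θ) ((1 - s) • barycenter (d + 1) + s • weight φ fun i => -augment d θ i) :=
      fun s => by
        rw [transportMap, logParam, sinv_softmax, portfolioAt_softmax hφ.contDiffOn, weightAt]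
    have e1 := e 1
    rw [sub_self, zero_smul, zero_add, one_smul] at e1
    rwa [← e t, ← e1, transportMap_logParam hd hφ ht, transportMap_logParam hd hφ h1mem] at h

/-- The Monge–Ampère equation for the interpolation. -/
theorem pullback_eq_withDensity (hd : 1 ≤ d) (hφ : Regular φ) (ht : t ∈ Set.Icc (0 : ℝ) 1)
    (hP : ClassLa P) :
    pullback P = volume.withDensity fun θ => ENNReal.ofReal (jacobian φ t θ).det *
      (interpolation P φ t).rnDeriv (refMeasure (d + 1)) (logParam (logMap φ t θ)) := by
  have := isProbabilityMeasure_pullback hP.toClassL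
  have hE := measurableEmbedding_logParam_logMap hd hφ ht
  have hac := interpolation_absolutelyContinuous hd hφ ht hP
  have hPt := interpolation_eq_map hd hφ ht hP.carried
  have : IsProbabilityMeasure (interpolation P φ t) := by
    rw [hPt]; exact Measure.isProbabilityMeasure_map hE.measurable.aemeasurable
  ext B hB
  rw [withDensity_apply _ hB]
  have h1 : pullback P B =
      interpolation P φ t ((fun θ => logParam (logMap φ t θ)) '' B) := by
    rw [hPt, hE.map_apply, Set.preimage_image_eq _ hE.injective]
  rw [h1, ← Measure.setLIntegral_rnDeriv hac,
    ← setLIntegral_image_logMap hd hφ ht hB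
      fun θ => (interpolation P φ t).rnDeriv (refMeasure (d + 1)) (logParam θ)]
  set ρ := (interpolation P φ t).rnDeriv (refMeasure (d + 1)) with hρ
  rw [refMeasure_eq_map, measurableEmbedding_logParam.restrict_map,
    measurableEmbedding_logParam.lintegral_map]
  have h2 : logParam ⁻¹' ((fun θ => logParam (logMap φ t θ)) '' B) = logMap φ t '' B := by
    rw [← Function.comp_def, Set.image_comp, Set.preimage_image_eq _ logParam_injective]
  rw [h2]

/-- The logarithm of the density of the interpolation, along the transport map. -/
def logDensity (P : Measure (Fin (d + 1) → ℝ)) (φ : (Fin (d + 1) → ℝ) → ℝ) (t : ℝ)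
    (θ : Fin d → ℝ) : ℝ :=
  Real.log ((pullback P).rnDeriv volume θ).toReal - Real.log (jacobian φ t θ).det

theorem measurable_logDensity (hd : 1 ≤ d) (hφ : Regular φ) (ht : t ∈ Set.Icc (0 : ℝ) 1) :
    Measurable (logDensity P φ t) :=
  (Real.measurable_log.comp (Measure.measurable_rnDeriv _ _).ennreal_toReal).sub
    (Real.measurable_log.comp (measurable_det_jacobian hd hφ ht))

theorem log_rnDeriv_interpolation (hd : 1 ≤ d) (hφ : Regular φ) (ht : t ∈ Set.Icc (0 : ℝ) 1)
    (hP : ClassLa P) : ∀ᵐ θ ∂(pullback P),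
      Real.log ((interpolation P φ t).rnDeriv (refMeasure (d + 1))
        (logParam (logMap φ t θ))).toReal = logDensity P φ t θ := by
  have := isProbabilityMeasure_pullback hP.toClassL
  have hac := pullback_absolutelyContinuous hP
  set ρ := (interpolation P φ t).rnDeriv (refMeasure (d + 1)) with hρ
  have hm : Measurable fun θ => ENNReal.ofReal (jacobian φ t θ).det *
      ρ (logParam (logMap φ t θ)) :=
    (measurable_det_jacobian hd hφ ht).ennreal_ofReal.mul
      ((Measure.measurable_rnDeriv _ _).comp (continuous_logParam_logMap hd hφ ht).measurable)
  have h1 := Measure.rnDeriv_withDensity volume hm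
  rw [← pullback_eq_withDensity hd hφ ht hP] at h1
  filter_upwards [hac h1, Measure.rnDeriv_pos hac, hac (Measure.rnDeriv_lt_top (pullback P) volume)]
    with θ hθ hpos hlt
  have hJ := det_jacobian_pos hd hφ ht θ
  -- The density of `pullback P` is positive `pullback P`-almost everywhere, hence so is each factor
  -- of the Monge–Ampère equation, and the logarithm splits.
  have hρ0 : (ρ (logParam (logMap φ t θ))).toReal ≠ 0 := by
    intro h0
    have h2 : ((pullback P).rnDeriv volume θ).toReal = 0 := by
      rw [hθ, ENNReal.toReal_mul, h0, mul_zero]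
    exact (ENNReal.toReal_pos hpos.ne' hlt.ne).ne' h2
  rw [logDensity, hθ, ENNReal.toReal_mul, ENNReal.toReal_ofReal hJ.le,
    Real.log_mul hJ.ne' hρ0]
  ring

/-- The sign `ε = ±1` treats the positive and negative parts of the entropy at once. -/
theorem lintegral_rnDeriv_mul_log {n : ℕ} {P μ : Measure (Fin n → ℝ)} [SigmaFinite P]
    [SigmaFinite μ] (hac : P ≪ μ) {ε : ℝ} :
    ∫⁻ p, ENNReal.ofReal (ε * ((P.rnDeriv μ p).toReal * Real.log (P.rnDeriv μ p).toReal)) ∂μ =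
      ∫⁻ p, ENNReal.ofReal (ε * Real.log (P.rnDeriv μ p).toReal) ∂P := by
  have hm : Measurable fun p => ENNReal.ofReal (ε * Real.log (P.rnDeriv μ p).toReal) :=
    ((Real.measurable_log.comp
      (Measure.measurable_rnDeriv P μ).ennreal_toReal).const_mul ε).ennreal_ofReal
  rw [← lintegral_rnDeriv_mul hac hm.aemeasurable]
  refine lintegral_congr_ae ?_
  filter_upwards [Measure.rnDeriv_lt_top P μ] with p hp
  conv_rhs => rw [← ENNReal.ofReal_toReal hp.ne, ← ENNReal.ofReal_mul ENNReal.toReal_nonneg]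
  rw [ENNReal.toReal_ofReal ENNReal.toReal_nonneg]
  congr 1
  ring

theorem ent_interpolation (hd : 1 ≤ d) (hφ : Regular φ) (ht : t ∈ Set.Icc (0 : ℝ) 1)
    (hP : ClassLa P) :
    entPos (interpolation P φ t) =
        ∫⁻ θ, ENNReal.ofReal (logDensity P φ t θ) ∂(pullback P) ∧
      entNeg (interpolation P φ t) =
        ∫⁻ θ, ENNReal.ofReal (-logDensity P φ t θ) ∂(pullback P) := by
  have := isProbabilityMeasure_pullback hP.toClassL
  have hcont := continuous_logParam_logMap hd hφ ht
  have hac := interpolation_absolutelyContinuous hd hφ ht hP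
  have hPt := interpolation_eq_map hd hφ ht hP.carried
  have : IsProbabilityMeasure (interpolation P φ t) := by
    rw [hPt]; exact Measure.isProbabilityMeasure_map hcont.aemeasurable
  have hae := log_rnDeriv_interpolation hd hφ ht hP
  set ρ := (interpolation P φ t).rnDeriv (refMeasure (d + 1)) with hρ
  have key : ∀ ε : ℝ, ∫⁻ p, ENNReal.ofReal (ε * entIntegrand (interpolation P φ t) p)
      ∂(refMeasure (d + 1)) =
      ∫⁻ θ, ENNReal.ofReal (ε * logDensity P φ t θ) ∂(pullback P) := by
    intro ε
    have h1 := lintegral_rnDeriv_mul_log hac (ε := ε)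
    rw [← hρ] at h1
    have hm : Measurable fun p => ENNReal.ofReal (ε * Real.log (ρ p).toReal) :=
      ((Real.measurable_log.comp
        (Measure.measurable_rnDeriv _ _).ennreal_toReal).const_mul ε).ennreal_ofReal
    refine h1.trans ?_
    rw [hPt, lintegral_map hm hcont.measurable]
    refine lintegral_congr_ae ?_
    filter_upwards [hae] with θ hθ
    rw [hθ]
  refine ⟨?_, ?_⟩
  · simpa only [one_mul, entPos] using key 1
  · simpa only [neg_one_mul, entNeg] using key (-1)

end Interpolation

/-! ### Integrability, and optimality of the transport maps. -/

section TransportCost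

theorem log_sum_mul_exp_le {n : ℕ} {w z : Fin n → ℝ} (hw : ∀ i, 0 ≤ w i) (hs : ∑ i, w i ≤ 1)
    (hpos : 0 < ∑ i, w i * Real.exp (z i)) :
    Real.log (∑ i, w i * Real.exp (z i)) ≤ ∑ i, |z i| := by
  rw [Real.log_le_iff_le_exp hpos]
  calc ∑ i, w i * Real.exp (z i) ≤ ∑ i, w i * Real.exp (∑ j, |z j|) := by
        refine Finset.sum_le_sum fun i _ =>
          mul_le_mul_of_nonneg_left (Real.exp_le_exp.mpr ?_) (hw i)
        exact (le_abs_self _).trans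
          (Finset.single_le_sum (fun j _ => abs_nonneg (z j)) (Finset.mem_univ i))
    _ = (∑ i, w i) * Real.exp (∑ j, |z j|) := by rw [Finset.sum_mul]
    _ ≤ Real.exp (∑ j, |z j|) := mul_le_of_le_one_left (Real.exp_pos _).le hs

theorem abs_mean_le {n : ℕ} [NeZero n] (z : Fin n → ℝ) :
    |1 / (n : ℝ) * ∑ i, z i| ≤ ∑ i, |z i| := by
  have hn : (1 : ℝ) ≤ n := by exact_mod_cast Nat.one_le_iff_ne_zero.mpr (NeZero.ne n)
  rw [abs_mul, abs_of_nonneg (by positivity)]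
  have h1 := Finset.abs_sum_le_sum_abs z Finset.univ
  have h2 : 1 / (n : ℝ) ≤ 1 := by rw [div_le_one (by linarith)]; exact hn
  exact (mul_le_of_le_one_left (abs_nonneg _) h2).trans h1

/-- One copy of `∑ |log pᵢ|` comes from the log-sum term, where the factors `qᵢ / n` have total mass
at most `1`; the other comes from the mean of `log (qᵢ / pᵢ)`. -/
theorem cost_le {n : ℕ} [NeZero n] {p q : Fin n → ℝ} (hp : p ∈ simplex n) (hq : q ∈ simplex n) :
    cost p q ≤ 2 * ∑ i, |Real.log (p i)| + ∑ i, |Real.log (q i)| := by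
  have hn : (1 : ℝ) ≤ n := by exact_mod_cast Nat.one_le_iff_ne_zero.mpr (NeZero.ne n)
  have e : 1 / (n : ℝ) * ∑ i, q i / p i =
      ∑ i, (1 / (n : ℝ) * q i) * Real.exp (-Real.log (p i)) := by
    rw [Finset.mul_sum]
    refine Finset.sum_congr rfl fun i _ => ?_
    rw [Real.exp_neg, Real.exp_log (hp.1 i)]
    ring
  have hn1 : 1 / (n : ℝ) ≤ 1 := by rw [div_le_one (by linarith)]; exact hn
  have hn0 : 0 < 1 / (n : ℝ) := by positivity
  have h1 := log_sum_mul_exp_le (w := fun i => 1 / (n : ℝ) * q i)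
    (z := fun i => -Real.log (p i)) (fun i => mul_nonneg hn0.le (hq.1 i).le)
    (by rw [← Finset.mul_sum, hq.2, mul_one]; exact hn1)
    (Finset.sum_pos (fun i _ => mul_pos (mul_pos hn0 (hq.1 i)) (Real.exp_pos _))
      Finset.univ_nonempty)
  have h2 := (neg_abs_le _).trans' (neg_le_neg (abs_mean_le fun i => Real.log (q i / p i)))
  have h3 : ∑ i, |Real.log (q i / p i)| ≤ ∑ i, |Real.log (q i)| + ∑ i, |Real.log (p i)| := by
    rw [← Finset.sum_add_distrib]
    refine Finset.sum_le_sum fun i _ => ?_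
    rw [Real.log_div (hq.1 i).ne' (hp.1 i).ne']
    exact abs_sub _ _
  simp only [abs_neg] at h1
  rw [cost, e]
  linarith

theorem measurable_cost {n : ℕ} :
    Measurable fun x : (Fin n → ℝ) × (Fin n → ℝ) => cost x.1 x.2 := by
  have h : ∀ i, Measurable fun x : (Fin n → ℝ) × (Fin n → ℝ) => x.2 i / x.1 i := fun i =>
    ((measurable_pi_apply i).comp measurable_snd).div ((measurable_pi_apply i).comp measurable_fst)
  exact (Real.measurable_log.comp
      ((Finset.measurable_fun_sum _ fun i _ => h i).const_mul (1 / (n : ℝ)))).sub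
    ((Finset.measurable_fun_sum _ fun i _ => Real.measurable_log.comp (h i)).const_mul
      (1 / (n : ℝ)))

/-- The fundamental inequality makes the potential `1`-Lipschitz for the `ℓ¹` norm, so the dual
potential grows at most linearly in logarithmic coordinates and is integrable. -/
theorem abs_dualPotential_le {n : ℕ} [NeZero n] (hn : 2 ≤ n) {φ : (Fin n → ℝ) → ℝ}
    (hφ : Regular φ) (a : Fin n → ℝ) :
    |dualPotential φ a| ≤ |potential φ 0| + 2 * ∑ i, |a i| := by
  have hbound : ∀ y y' : Fin n → ℝ, potential φ y' - potential φ y ≤ ∑ i, |y' i - y i| :=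
    fun y y' => ((potential_sub_le_log hφ y y').1).trans
      (log_sum_mul_exp_le (fun i => weight_nonneg hn hφ y i) (sum_weight hφ.contDiffOn y).le
        (Finset.sum_pos (fun i _ => mul_pos (weight_pos hn hφ y i) (Real.exp_pos _))
          Finset.univ_nonempty))
  have h1 := hbound 0 (fun i => -a i)
  have h2 := hbound (fun i => -a i) 0
  simp only [Pi.zero_apply, sub_zero, abs_neg, zero_sub, neg_neg] at h1 h2
  have h3 := abs_le.mp (abs_mean_le a)
  have h4 := neg_abs_le (potential φ 0)
  have h5 := le_abs_self (potential φ 0)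
  rw [dualPotential, abs_le]
  constructor <;> linarith [h3.1, h3.2]

variable {d : ℕ} {φ : (Fin (d + 1) → ℝ) → ℝ} {P : Measure (Fin (d + 1) → ℝ)} {t : ℝ}

theorem integrable_abs_log {Ω : Type*} [MeasurableSpace Ω] {Q : Measure Ω}
    {f : Ω → Fin (d + 1) → ℝ} (hf : Measurable f) (hP : ClassL (Q.map f)) (i : Fin (d + 1)) :
    Integrable (fun ω => |Real.log (f ω i)|) Q := by
  have h := hP.logMoment
  simp only [lintegral_map (measurable_abs_log _) hf] at h
  have hi := (ENNReal.sum_lt_top.mp h) i (Finset.mem_univ i)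
  have hm : Measurable fun ω => |Real.log (f ω i)| := by fun_prop
  refine ⟨hm.aestronglyMeasurable, ?_⟩
  rw [hasFiniteIntegral_iff_norm]
  simpa using hi

theorem integrable_abs_augment (hP : ClassL P) (i : Fin (d + 1)) :
    Integrable (fun θ => |augment d θ i|) (pullback P) := by
  have hint := fun j => integrable_abs_log continuous_logParam.measurable
    ((map_pullback hP.carried).symm ▸ hP) j
  have hm : Continuous fun θ => |augment d θ i| :=
    ((continuous_apply i).comp (augment d).continuous).abs
  refine ((hint i).add (hint (Fin.last d))).mono' hm.aestronglyMeasurable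
    (Filter.Eventually.of_forall fun θ => ?_)
  have h1 := log_softmax (augment d θ) i
  have h2 := log_softmax (augment d θ) (Fin.last d)
  have h3 : augment d θ i = Real.log (logParam θ i) - Real.log (logParam θ (Fin.last d)) := by
    rw [logParam, h1, h2, augment_last]; ring
  rw [Real.norm_eq_abs, abs_abs, h3]
  exact abs_sub _ _

theorem continuous_dualPotential (hφ : ContDiffOn ℝ 2 φ (simplex (d + 1))) :
    Continuous (dualPotential φ) := by
  have h := (contDiff_potential hφ).continuous
  unfold dualPotential
  fun_prop

theorem integrable_dualPotential (hd : 1 ≤ d) (hφ : Regular φ) (hP : ClassL P) :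
    Integrable (fun θ => dualPotential φ (augment d θ)) (pullback P) := by
  have := isProbabilityMeasure_pullback hP
  have hc : Continuous fun θ => dualPotential φ (augment d θ) :=
    (continuous_dualPotential hφ.contDiffOn).comp (augment d).continuous
  refine ((integrable_const |potential φ 0|).add ((integrable_finsetSum Finset.univ
    fun i _ => integrable_abs_augment hP i).const_mul 2)).mono' hc.aestronglyMeasurable
    (Filter.Eventually.of_forall fun θ => ?_)
  exact abs_dualPotential_le (by omega) hφ _

theorem measurable_cost_logMap (hd : 1 ≤ d) (hφ : Regular φ) (ht : t ∈ Set.Icc (0 : ℝ) 1) :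
    Measurable fun θ => cost (logParam θ) (logParam (logMap φ t θ)) := by
  have hpair : Measurable fun θ => (logParam θ, logParam (logMap φ t θ)) :=
    continuous_logParam.measurable.prodMk (continuous_logParam_logMap hd hφ ht).measurable
  have h := measurable_cost.comp hpair
  simpa only [Function.comp_def] using h

theorem integrable_cost (hd : 1 ≤ d) (hφ : Regular φ) (ht : t ∈ Set.Icc (0 : ℝ) 1)
    (hP : ClassL P) (hPt : ClassL (interpolation P φ t)) :
    Integrable (fun θ => cost (logParam θ) (logParam (logMap φ t θ))) (pullback P) := by
  have h0 := fun j => integrable_abs_log continuous_logParam.measurable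
    ((map_pullback hP.carried).symm ▸ hP) j
  rw [interpolation_eq_map hd hφ ht hP.carried] at hPt
  have h1 := fun j => integrable_abs_log (continuous_logParam_logMap hd hφ ht).measurable hPt j
  refine (((integrable_finsetSum Finset.univ fun i _ => h0 i).const_mul 2).add
    (integrable_finsetSum Finset.univ fun i _ => h1 i)).mono'
    (measurable_cost_logMap hd hφ ht).aestronglyMeasurable
    (Filter.Eventually.of_forall fun θ => ?_)
  have h0 : 0 ≤ cost (logParam θ) (logParam (logMap φ t θ)) := cost_softmax_nonneg _ _
  rw [Real.norm_eq_abs, abs_of_nonneg h0]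
  exact cost_le (logParam_mem _) (logParam_mem _)

/-- Needed because the sum of the dual functions may be negative, whereas the transport cost is an
integral in `ENNReal`. -/
theorem ofReal_integral_le_lintegral {Ω : Type*} [MeasurableSpace Ω] {Q : Measure Ω}
    {f : Ω → ℝ} (hf : Integrable f Q) :
    ENNReal.ofReal (∫ ω, f ω ∂Q) ≤ ∫⁻ ω, ENNReal.ofReal (f ω) ∂Q := by
  rw [integral_eq_lintegral_pos_part_sub_lintegral_neg_part hf]
  exact (ENNReal.ofReal_le_ofReal (sub_le_self _ ENNReal.toReal_nonneg)).trans
    ENNReal.ofReal_toReal_le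

/-- The transport maps are optimal. -/
theorem transportCost_interpolation (hd : 1 ≤ d) (hφ : Regular φ) (ht : t ∈ Set.Icc (0 : ℝ) 1)
    (hP : ClassL P) (hPt : ClassL (interpolation P φ t)) :
    transportCost P (interpolation P φ t) = ENNReal.ofReal
      (∫ θ, cost (logParam θ) (logParam (logMap φ t θ)) ∂(pullback P)) := by
  have hint := integrable_cost hd hφ ht hP hPt
  have hdual := integrable_dualPotential hd hφ hP
  have hE := measurableEmbedding_logParam (d := d)
  have hES := measurableEmbedding_logParam_logMap hd hφ ht
  have hmap := map_pullback hP.carried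
  have hmapt := interpolation_eq_map hd hφ ht hP.carried
  refine le_antisymm ?_ ?_
  · have hpair : Measurable fun θ => (logParam θ, logParam (logMap φ t θ)) :=
      hE.measurable.prodMk hES.measurable
    have hmem : ((pullback P).map fun θ => (logParam θ, logParam (logMap φ t θ))) ∈
        couplings P (interpolation P φ t) := by
      refine ⟨?_, ?_⟩
      · rw [Measure.map_map measurable_fst hpair]
        exact hmap
      · rw [Measure.map_map measurable_snd hpair]
        exact hmapt.symm
    refine (iInf₂_le _ hmem).trans_eq ?_
    rw [lintegral_map measurable_cost.ennreal_ofReal hpair,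
      ofReal_integral_eq_lintegral_ofReal hint
        (Filter.Eventually.of_forall fun θ => cost_softmax_nonneg _ _)]
  · refine le_iInf₂ fun γ hγ => ?_
    obtain ⟨hγ1, hγ2⟩ := hγ
    have hdm : Measurable fun θ => dualPotential φ (augment d θ) :=
      ((continuous_dualPotential hφ.contDiffOn).comp (augment d).continuous).measurable
    -- Weak duality: `u` is `t` times the dual potential and `v` is the cost along the map minus
    -- `u`, so that `u(x) + v(y) ≤ c(x, y)`. Both are prescribed only on the ranges of embeddings;
    -- the extensions elsewhere do not matter, since `γ` is carried by these ranges.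
    obtain ⟨u, hu, hue⟩ := hE.exists_measurable_extend (hdm.const_mul t) fun _ => inferInstance
    obtain ⟨v, hv, hve⟩ := hES.exists_measurable_extend
      ((measurable_cost_logMap hd hφ ht).sub (hdm.const_mul t)) fun _ => inferInstance
    have hue' : ∀ θ, u (logParam θ) = t * dualPotential φ (augment d θ) := congrFun hue
    have hve' : ∀ θ, v (logParam (logMap φ t θ)) =
        cost (logParam θ) (logParam (logMap φ t θ)) - t * dualPotential φ (augment d θ) :=
      congrFun hve
    have huint : Integrable u P := by
      rw [← hmap, hE.integrable_map_iff, hue]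
      exact hdual.const_mul t
    have hvint : Integrable v (interpolation P φ t) := by
      rw [hmapt, hES.integrable_map_iff, hve]
      exact hint.sub (hdual.const_mul t)
    have huI : ∫ p, u p ∂P = ∫ θ, t * dualPotential φ (augment d θ) ∂(pullback P) := by
      conv_lhs => rw [← hmap]
      rw [hE.integral_map]
      simp only [hue']
    have hvI : ∫ p, v p ∂(interpolation P φ t) =
        ∫ θ, cost (logParam θ) (logParam (logMap φ t θ)) ∂(pullback P) -
          ∫ θ, t * dualPotential φ (augment d θ) ∂(pullback P) := by
      rw [hmapt, hES.integral_map]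
      simp only [hve']
      exact integral_sub hint (hdual.const_mul t)
    have hu1 : Integrable (fun x : (Fin (d + 1) → ℝ) × (Fin (d + 1) → ℝ) => u x.1) γ := by
      rw [← hγ1] at huint
      exact (integrable_map_measure hu.aestronglyMeasurable measurable_fst.aemeasurable).mp huint
    have hv1 : Integrable (fun x : (Fin (d + 1) → ℝ) × (Fin (d + 1) → ℝ) => v x.2) γ := by
      rw [← hγ2] at hvint
      exact (integrable_map_measure hv.aestronglyMeasurable measurable_snd.aemeasurable).mp hvint
    have hI : ∫ x, (u x.1 + v x.2) ∂γ =
        ∫ θ, cost (logParam θ) (logParam (logMap φ t θ)) ∂(pullback P) := by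
      have e1 : ∫ x, u x.1 ∂γ = ∫ p, u p ∂P := by
        rw [← hγ1, integral_map measurable_fst.aemeasurable hu.aestronglyMeasurable]
      have e2 : ∫ x, v x.2 ∂γ = ∫ p, v p ∂(interpolation P φ t) := by
        rw [← hγ2, integral_map measurable_snd.aemeasurable hv.aestronglyMeasurable]
      rw [integral_add hu1 hv1, e1, e2, huI, hvI]
      ring
    have hr1 : ∀ᵐ x ∂γ, x.1 ∈ Set.range (logParam (d := d)) := by
      have h : ∀ᵐ p ∂(γ.map Prod.fst), p ∈ Set.range (logParam (d := d)) := by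
        rw [hγ1, range_logParam]
        exact mem_ae_iff.mpr hP.carried
      exact ae_of_ae_map measurable_fst.aemeasurable h
    have hr2 : ∀ᵐ x ∂γ, x.2 ∈ Set.range (fun θ => logParam (logMap φ t θ)) := by
      have h : ∀ᵐ p ∂(γ.map Prod.snd), p ∈ Set.range (fun θ => logParam (logMap φ t θ)) := by
        rw [hγ2, hmapt, hES.ae_map_iff]
        exact Filter.Eventually.of_forall fun θ => ⟨θ, rfl⟩
      exact ae_of_ae_map measurable_snd.aemeasurable h
    rw [← hI]
    refine (ofReal_integral_le_lintegral (hu1.add hv1)).trans (lintegral_mono_ae ?_)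
    filter_upwards [hr1, hr2] with x hx1 hx2
    obtain ⟨θ', hθ'⟩ := hx1
    obtain ⟨θ, hθ⟩ := hx2
    refine ENNReal.ofReal_le_ofReal ?_
    simp only [← hθ', ← hθ, hue', hve', Pi.add_apply]
    have h := (dualPotential_sub_le (by omega) hφ ht (augment d θ) (augment d θ')).1
    rw [← logParam_logMap hφ.contDiffOn] at h
    change _ ≤ cost (logParam θ') _ - cost (logParam θ) _ at h
    linarith

end TransportCost

/-! ### From pointwise convexity to the extended-real functional. -/

section Convexity

variable {Ω : Type*} [MeasurableSpace Ω] {Q : Measure Ω}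

/-- The extended-real value of `∫ f + N ∫ c`. -/
def extFunctional (Q : Measure Ω) (f c : Ω → ℝ) (N : ℝ) : EReal :=
  ((∫⁻ ω, ENNReal.ofReal (f ω) ∂Q : ENNReal) : EReal) -
      ((∫⁻ ω, ENNReal.ofReal (-f ω) ∂Q : ENNReal) : EReal) +
    (N : EReal) * ((ENNReal.ofReal (∫ ω, c ω ∂Q) : ENNReal) : EReal)

theorem integrable_of_lintegral_ofReal_ne_top {f : Ω → ℝ} (hf : Measurable f)
    (hpos : ∫⁻ ω, ENNReal.ofReal (f ω) ∂Q ≠ ⊤) (hneg : ∫⁻ ω, ENNReal.ofReal (-f ω) ∂Q ≠ ⊤) :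
    Integrable f Q := by
  refine ⟨hf.aestronglyMeasurable, ?_⟩
  rw [hasFiniteIntegral_iff_norm]
  refine lt_of_le_of_lt (lintegral_mono fun ω => ?_)
    ((lintegral_add_left hf.ennreal_ofReal fun ω => ENNReal.ofReal (-f ω)).trans_lt
      (ENNReal.add_lt_top.mpr ⟨hpos.lt_top, hneg.lt_top⟩))
  rcases le_total 0 (f ω) with h | h
  · rw [Real.norm_eq_abs, abs_of_nonneg h]; exact le_self_add
  · rw [Real.norm_eq_abs, abs_of_nonpos h]; exact le_add_self

theorem extFunctional_of_integrable {f c : Ω → ℝ} (hf : Integrable f Q)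
    (hc0 : 0 ≤ ∫ ω, c ω ∂Q) (N : ℝ) :
    extFunctional Q f c N = ((∫ ω, f ω ∂Q + N * ∫ ω, c ω ∂Q : ℝ) : EReal) := by
  have h1 := hf.lintegral_lt_top
  have h2 := hf.neg.lintegral_lt_top
  simp only [Pi.neg_apply] at h2
  rw [extFunctional, integral_eq_lintegral_pos_part_sub_lintegral_neg_part hf, EReal.coe_add,
    EReal.coe_sub, EReal.coe_mul, EReal.coe_ennreal_ofReal, max_eq_left hc0,
    EReal.coe_ennreal_toReal h1.ne, EReal.coe_ennreal_toReal h2.ne]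

theorem extFunctional_of_not_integrable {f c : Ω → ℝ} (hfm : Measurable f)
    (hneg : ∫⁻ ω, ENNReal.ofReal (-f ω) ∂Q < ⊤) (hf : ¬ Integrable f Q)
    (hc0 : 0 ≤ ∫ ω, c ω ∂Q) (N : ℝ) : extFunctional Q f c N = ⊤ := by
  have hpos : ∫⁻ ω, ENNReal.ofReal (f ω) ∂Q = ⊤ := by
    by_contra h
    exact hf (integrable_of_lintegral_ofReal_ne_top hfm h hneg.ne)
  rw [extFunctional, hpos, EReal.coe_ennreal_ofReal, max_eq_left hc0, ← EReal.coe_mul,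
    ← EReal.coe_ennreal_toReal hneg.ne, EReal.coe_ennreal_top, EReal.top_sub_coe,
    EReal.top_add_coe]

/-- Convexity of the integrand passes to the extended-real functional. -/
theorem extFunctional_convex {f c : ℝ → Ω → ℝ} {S : Set ℝ} (hS : Convex ℝ S) {N : ℝ}
    (hfm : ∀ t ∈ S, Measurable (f t))
    (hneg : ∀ t ∈ S, ∫⁻ ω, ENNReal.ofReal (-f t ω) ∂Q < ⊤)
    (hc : ∀ t ∈ S, Integrable (c t) Q) (hc0 : ∀ t ∈ S, 0 ≤ ∫ ω, c t ω ∂Q)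
    (hconv : ∀ s ∈ S, ∀ t ∈ S, ∀ a b : ℝ, 0 ≤ a → 0 ≤ b → a + b = 1 → ∀ ω,
      f (a * s + b * t) ω + N * c (a * s + b * t) ω ≤
        a * (f s ω + N * c s ω) + b * (f t ω + N * c t ω)) :
    EConvexOn S fun t => extFunctional Q (f t) (c t) N := by
  intro s hs t ht a b ha hb hab
  change extFunctional Q (f (a * s + b * t)) (c (a * s + b * t)) N ≤
    (a : EReal) * extFunctional Q (f s) (c s) N + (b : EReal) * extFunctional Q (f t) (c t) N
  have hm : a * s + b * t ∈ S := hS hs ht ha hb hab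
  rcases ha.eq_or_lt with h0 | ha'
  · subst h0
    obtain rfl : b = 1 := by linarith
    simp
  rcases hb.eq_or_lt with h0 | hb'
  · subst h0
    obtain rfl : a = 1 := by linarith
    simp
  -- No value is `-∞`, so an infinite term on the right-hand side makes that side `⊤` and the
  -- inequality trivial.
  have hbot : ∀ r ∈ S, ∀ x : ℝ, 0 < x → (x : EReal) * extFunctional Q (f r) (c r) N ≠ ⊥ := by
    intro r hr x hx
    by_cases hf : Integrable (f r) Q
    · rw [extFunctional_of_integrable hf (hc0 r hr), ← EReal.coe_mul]; exact EReal.coe_ne_bot _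
    · rw [extFunctional_of_not_integrable (hfm r hr) (hneg r hr) hf (hc0 r hr),
        EReal.coe_mul_top_of_pos hx]
      exact top_ne_bot
  by_cases hfs : Integrable (f s) Q
  swap
  · rw [extFunctional_of_not_integrable (hfm s hs) (hneg s hs) hfs (hc0 s hs),
      EReal.coe_mul_top_of_pos ha', EReal.top_add_of_ne_bot (hbot t ht b hb')]
    exact le_top
  by_cases hft : Integrable (f t) Q
  swap
  · rw [extFunctional_of_not_integrable (hfm t ht) (hneg t ht) hft (hc0 t ht),
      EReal.coe_mul_top_of_pos hb', EReal.add_top_of_ne_bot (hbot s hs a ha')]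
    exact le_top
  have hgs : Integrable (fun ω => a * (f s ω + N * c s ω)) Q :=
    (hfs.add ((hc s hs).const_mul N)).const_mul a
  have hgt : Integrable (fun ω => b * (f t ω + N * c t ω)) Q :=
    (hft.add ((hc t ht).const_mul N)).const_mul b
  have hgi : Integrable (fun ω => a * (f s ω + N * c s ω) + b * (f t ω + N * c t ω)) Q :=
    hgs.add hgt
  -- The positive part is dominated through the convexity inequality, the negative part is
  -- integrable by assumption.
  have hfi : Integrable (f (a * s + b * t)) Q := by
    have hg2 := hgi.sub ((hc _ hm).const_mul N)
    refine integrable_of_lintegral_ofReal_ne_top (hfm _ hm) (ne_top_of_le_ne_top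
      hg2.lintegral_lt_top.ne (lintegral_mono fun ω => ENNReal.ofReal_le_ofReal ?_)) (hneg _ hm).ne
    have := hconv s hs t ht a b ha hb hab ω
    simp only [Pi.sub_apply]
    linarith
  rw [extFunctional_of_integrable hfi (hc0 _ hm), extFunctional_of_integrable hfs (hc0 s hs),
    extFunctional_of_integrable hft (hc0 t ht), ← EReal.coe_mul, ← EReal.coe_mul, ← EReal.coe_add,
    EReal.coe_le_coe_iff]
  have e : ∀ r ∈ S, Integrable (f r) Q → ∫ ω, f r ω ∂Q + N * ∫ ω, c r ω ∂Q =
      ∫ ω, (f r ω + N * c r ω) ∂Q := fun r hr hfr => by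
    rw [integral_add hfr ((hc r hr).const_mul N), integral_const_mul]
  rw [e _ hm hfi, e s hs hfs, e t ht hft, ← integral_const_mul, ← integral_const_mul,
    ← integral_add hgs hgt]
  exact integral_mono (hfi.add ((hc _ hm).const_mul N)) hgi
    fun ω => hconv s hs t ht a b ha hb hab ω

end Convexity

/-! ### Convexity of entropy plus cost. -/

section Main

variable {d : ℕ} {φ : (Fin (d + 1) → ℝ) → ℝ} {P : Measure (Fin (d + 1) → ℝ)}

/-- After the cancellation, `t` occurs only in the log-determinant; the density of `P₀` and the
constant do not affect convexity. -/
theorem logDensity_add_cost (hd : 1 ≤ d) (hφ : Regular φ) {t : ℝ} (ht : t ∈ Set.Icc (0 : ℝ) 1)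
    (θ : Fin d → ℝ) :
    logDensity P φ t θ + ((d + 1 : ℕ) : ℝ) * cost (logParam θ) (logParam (logMap φ t θ)) =
      Real.log ((pullback P).rnDeriv volume θ).toReal -
        Real.log (interpMatrix φ t (-θ)).det -
        ((d + 1 : ℕ) : ℝ) * Real.log ((d + 1 : ℕ) : ℝ) := by
  have h := neg_log_det_jacobian_add_cost hd hφ ht θ
  rw [logDensity]
  linarith

theorem entropy_add_transportCost_convex (hd : 1 ≤ d) (hφ : Regular φ) (hP : ClassLa P)
    (hPt : ∀ t ∈ Set.Icc (0 : ℝ) 1, ClassLa (interpolation P φ t)) :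
    EConvexOn (Set.Icc (0 : ℝ) 1) fun t => entropy (interpolation P φ t) +
      ((d + 1 : ℕ) : EReal) * (transportCost P (interpolation P φ t) : EReal) := by
  have hneg : ∀ t ∈ Set.Icc (0 : ℝ) 1, entNeg (interpolation P φ t) < ⊤ := fun t ht =>
    entNeg_lt_top (hPt t ht).toClassL (interpolation_absolutelyContinuous hd hφ ht hP)
  have hconv := extFunctional_convex (Q := pullback P) (f := logDensity P φ)
    (c := fun t θ => cost (logParam θ) (logParam (logMap φ t θ))) (convex_Icc (0 : ℝ) 1)
    (N := ((d + 1 : ℕ) : ℝ))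
    (fun t ht => measurable_logDensity hd hφ ht)
    (fun t ht => by rw [← (ent_interpolation hd hφ ht hP).2]; exact hneg t ht)
    (fun t ht => integrable_cost hd hφ ht hP.toClassL (hPt t ht).toClassL)
    (fun t ht => integral_nonneg fun θ => cost_softmax_nonneg _ _)
    (fun s hs t ht a b ha hb hab θ => by
      have hm : a * s + b * t ∈ Set.Icc (0 : ℝ) 1 := convex_Icc (0 : ℝ) 1 hs ht ha hb hab
      simp only [logDensity_add_cost hd hφ hs, logDensity_add_cost hd hφ ht,
        logDensity_add_cost hd hφ hm]
      have h := log_det_interpMatrix_concave hd hφ hs ht ha hb hab (-θ)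
      obtain rfl : b = 1 - a := by linarith
      linarith)
  have heq : ∀ t ∈ Set.Icc (0 : ℝ) 1, entropy (interpolation P φ t) +
      ((d + 1 : ℕ) : EReal) * (transportCost P (interpolation P φ t) : EReal) =
      extFunctional (pullback P) (logDensity P φ t)
        (fun θ => cost (logParam θ) (logParam (logMap φ t θ))) ((d + 1 : ℕ) : ℝ) := by
    intro t ht
    rw [entropy, (ent_interpolation hd hφ ht hP).1, (ent_interpolation hd hφ ht hP).2,
      transportCost_interpolation hd hφ ht hP.toClassL (hPt t ht).toClassL, extFunctional]
    rfl
  intro s hs t ht a b ha hb hab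
  have hm : a * s + b * t ∈ Set.Icc (0 : ℝ) 1 := convex_Icc (0 : ℝ) 1 hs ht ha hb hab
  simpa only [heq s hs, heq t ht, heq _ hm] using hconv s hs t ht a b ha hb hab

end Main

end DirichletTransport

end

theorem theorem16 (n : ℕ) (hn : 2 ≤ n) (P₀ P₁ : MeasureTheory.Measure (Fin n → ℝ))
    (hP₀ : DirichletTransport.ClassLa P₀) (hP₁ : DirichletTransport.ClassLa P₁)
    (φ₁ : (Fin n → ℝ) → ℝ)
    (hconc : DirichletTransport.ExpConcave φ₁)
    (hreg : DirichletTransport.Regular φ₁)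
    (hpush : P₀.map (fun p => DirichletTransport.odot p
      (DirichletTransport.portfolio φ₁ (DirichletTransport.sinv p))) = P₁) :
    (∀ t ∈ Set.Icc (0 : ℝ) 1,
      DirichletTransport.ClassLa (DirichletTransport.interpolation P₀ φ₁ t) ∧
      (DirichletTransport.interpolation P₀ φ₁ t).AbsolutelyContinuous
        (DirichletTransport.refMeasure n) ∧
      DirichletTransport.entNeg (DirichletTransport.interpolation P₀ φ₁ t) < ⊤ ∧
      DirichletTransport.transportCost P₀ (DirichletTransport.interpolation P₀ φ₁ t) < ⊤) ∧
    DirichletTransport.EConvexOn (Set.Icc (0 : ℝ) 1) (fun t =>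
      DirichletTransport.entropy (DirichletTransport.interpolation P₀ φ₁ t) +
        (n : EReal) * (DirichletTransport.transportCost P₀
          (DirichletTransport.interpolation P₀ φ₁ t) : EReal)) := by
  obtain ⟨d, rfl⟩ : ∃ d, n = d + 1 := ⟨n - 1, by omega⟩
  have hd : 1 ≤ d := by omega
  -- At `t = 1` the barycenter drops out, so the endpoint is `P₁` and provides the second log-moment
  -- bound.
  have h1 : DirichletTransport.interpolation P₀ φ₁ 1 = P₁ := by
    rw [← hpush, DirichletTransport.interpolation]
    congr 1
    ext1 p
    simp [DirichletTransport.transportMap, DirichletTransport.portfolioAt]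
  have hPt : ∀ t ∈ Set.Icc (0 : ℝ) 1,
      DirichletTransport.ClassLa (DirichletTransport.interpolation P₀ φ₁ t) := fun t ht =>
    DirichletTransport.interpolation_classLa hd hreg ht hP₀ (h1.symm ▸ hP₁.toClassL)
  refine ⟨fun t ht => ?_,
    DirichletTransport.entropy_add_transportCost_convex hd hreg hP₀ hPt⟩
  have hac := DirichletTransport.interpolation_absolutelyContinuous hd hreg ht hP₀
  refine ⟨hPt t ht, hac, DirichletTransport.entNeg_lt_top (hPt t ht).toClassL hac, ?_⟩
  rw [DirichletTransport.transportCost_interpolation hd hreg ht hP₀.toClassL (hPt t ht).toClassL]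
  exact ENNReal.ofReal_lt_top
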